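/- **Theorem (sharp Hardy inequality with remainder).** Let $N\ge 1$, $2\le p<\infty$ and $0<s<1$ with $ps\ne 1$. Let $\mathbb{R}^N_+=\{x=(x',x_N):x'\in\mathbb{R}^{N-1},\,x_N>0\}$ and let $\mathcal W^s_p(\mathbb{R}^N_+)$ be the completion of $C_0^\infty(\mathbb{R}^N_+)$ (real- or complex-valued) with respect to the Gagliardo energy $$E[u]=\iint_{\mathbb{R}^N_+\times\mathbb{R}^N_+}\frac{|u(x)-u(y)|^p}{|x-y|^{N+ps}}\,dx\,dy ,$$ regarded as a space of functions, that is, the set of all $u$ that are almost everywhere limits on $\mathbb{R}^N_+$ of sequences $(\varphi_k)$ in $C_0^\infty(\mathbb{R}^N_+)$ with $E[\varphi_k-\varphi_l]\to 0$ as $k,l\to\infty$. Put $$\mathcal D_{N,p,s}=2\pi^{(N-1)/2}\,\frac{\Gamma((1+ps)/2)}{\Gamma((N+ps)/2)}\int_0^1\bigl|1-r^{(ps-1)/p}\bigr|^p\frac{dr}{(1-r)^{1+ps}},\qquad c_p=\min_{0<\tau<1/2}\bigl((1-\tau)^p-\tau^p+p\tau^{p-1}\bigr).$$ The integral in $\mathcal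 D_{N,p,s}$ converges, the minimum is attained, and $0<c_p\le 1$. For every $u\in\mathcal W^s_p(\mathbb{R}^N_+)$ and $v=x_N^{(1-ps)/p}u$, all the integrals in the following inequality are finite, and $$\iint_{\mathbb{R}^N_+\times\mathbb{R}^N_+}\frac{|u(x)-u(y)|^p}{|x-y|^{N+ps}}\,dx\,dy-\mathcal D_{N,p,s}\int_{\mathbb{R}^N_+}\frac{|u(x)|^p}{x_N^{ps}}\,dx\;\ge\; c_p\iint_{\mathbb{R}^N_+\times\mathbb{R}^N_+}\frac{|v(x)-v(y)|^p}{|x-y|^{N+ps}}\,\frac{dx}{x_N^{(1-ps)/2}}\,\frac{dy}{y_N^{(1-ps)/2}} .$$ If $p=2$, then $c_2=1$ and equality holds. -/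

import Mathlib

open MeasureTheory Filter Topology
open scoped ENNReal ContDiff

/-- The open half-space `{x : x_N > 0}` of `ℝ^N`, where `N = n + 1 ≥ 1`;
the last coordinate `x_N` is `x (Fin.last n)`. -/
def halfSpace (n : ℕ) : Set (EuclideanSpace ℝ (Fin (n + 1))) :=
  {x | 0 < x (Fin.last n)}

/-- The Gagliardo energy `∬ |u(x) - u(y)|^p / |x - y|^(N + ps) dx dy` over the half-space,
with `N = n + 1`, as an element of `[0, ∞]`. -/
noncomputable def gagliardoEnergy {𝕜 : Type*} [RCLike 𝕜] {n : ℕ} (p s : ℝ)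
    (u : EuclideanSpace ℝ (Fin (n + 1)) → 𝕜) : ℝ≥0∞ :=
  ∫⁻ x in halfSpace n, ∫⁻ y in halfSpace n,
    ENNReal.ofReal (‖u x - u y‖ ^ p / ‖x - y‖ ^ (((n + 1 : ℕ) : ℝ) + p * s))

/-- The Hardy term `∫ |u(x)|^p x_N^(-ps) dx` over the half-space. -/
noncomputable def hardyTerm {𝕜 : Type*} [RCLike 𝕜] {n : ℕ} (p s : ℝ)
    (u : EuclideanSpace ℝ (Fin (n + 1)) → 𝕜) : ℝ≥0∞ :=
  ∫⁻ x in halfSpace n, ENNReal.ofReal (‖u x‖ ^ p / x (Fin.last n) ^ (p * s))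

/-- The weighted energy
`∬ |v(x) - v(y)|^p / |x - y|^(N + ps) · x_N^(-(1-ps)/2) y_N^(-(1-ps)/2) dx dy`
over the half-space, with `N = n + 1`. -/
noncomputable def weightedEnergy {𝕜 : Type*} [RCLike 𝕜] {n : ℕ} (p s : ℝ)
    (v : EuclideanSpace ℝ (Fin (n + 1)) → 𝕜) : ℝ≥0∞ :=
  ∫⁻ x in halfSpace n, ∫⁻ y in halfSpace n,
    ENNReal.ofReal (‖v x - v y‖ ^ p / ‖x - y‖ ^ (((n + 1 : ℕ) : ℝ) + p * s)
      / x (Fin.last n) ^ ((1 - p * s) / 2) / y (Fin.last n) ^ ((1 - p * s) / 2))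

/-- `φ ∈ C_0^∞` of the open half-space: smooth with compact support inside it. -/
def IsTestFunction {𝕜 : Type*} [RCLike 𝕜] {n : ℕ}
    (φ : EuclideanSpace ℝ (Fin (n + 1)) → 𝕜) : Prop :=
  ContDiff ℝ ∞ φ ∧ HasCompactSupport φ ∧ tsupport φ ⊆ halfSpace n

/-- The completion of `C_0^∞` of the half-space with respect to the Gagliardo energy, realised as
a space of functions: `u` belongs to it if it is the almost everywhere limit on the half-space of
a sequence of test functions which is a Cauchy sequence for the Gagliardo energy. -/
def MemW {𝕜 : Type*} [RCLike 𝕜] {n : ℕ} (p s : ℝ)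
    (u : EuclideanSpace ℝ (Fin (n + 1)) → 𝕜) : Prop :=
  ∃ φ : ℕ → EuclideanSpace ℝ (Fin (n + 1)) → 𝕜,
    (∀ k, IsTestFunction (φ k)) ∧
    Tendsto (fun m : ℕ × ℕ => gagliardoEnergy p s (φ m.1 - φ m.2)) atTop (𝓝 0) ∧
    ∀ᵐ x ∂(volume.restrict (halfSpace n)), Tendsto (fun k => φ k x) atTop (𝓝 (u x))

/-- The integrand `|1 - r^((ps-1)/p)|^p / (1-r)^(1+ps)` in the sharp Hardy constant. -/
noncomputable def hardyIntegrand (p s r : ℝ) : ℝ :=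
  |1 - r ^ ((p * s - 1) / p)| ^ p / (1 - r) ^ (1 + p * s)

/-- The sharp Hardy constant `D_{N,p,s}`. -/
noncomputable def hardyConst (N : ℕ) (p s : ℝ) : ℝ :=
  2 * Real.pi ^ (((N : ℝ) - 1) / 2)
    * (Real.Gamma ((1 + p * s) / 2) / Real.Gamma (((N : ℝ) + p * s) / 2))
    * ∫ r in (0 : ℝ)..1, hardyIntegrand p s r

/-- The function `(1-τ)^p - τ^p + p τ^(p-1)` whose minimum over `(0, 1/2)` is `c_p`. -/
noncomputable def remainderFun (p τ : ℝ) : ℝ :=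
  (1 - τ) ^ p - τ ^ p + p * τ ^ (p - 1)

/-!
The ground state of the problem is the function `ω(x) = x_N ^ β` with `β = (ps - 1) / p`, and the
proof writes `u = ω v` and compares the energy density of `u` with that of `v`.

*Pointwise inequality.* For `a ≥ b > 0` and vectors `X`, `Y`,
`|aX - bY|^p ≥ (a - b)^(p-1) (a|X|^p - b|Y|^p) + c_p (ab)^(p/2) |X - Y|^p`
(`norm_smul_sub_smul_rpow_ge`), with equality for `p = 2`. After scaling to `ab = 1`, set
`Z = X - Y`, `η = (a - b) / 2`, `k = (a + b) / 2`, so that `k² = 1 + η²`. Along the line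
`ψ(ξ) = |m + ξ Z|^p`, `m = η (X + Y)`, the inequality says that the second divided difference of `ψ`
at `-η`, `η`, `k` is at least `c_p |Z|^p`. For `η = 0` this is the sharp inequality
`|m + Z|^p ≥ |m|^p + p |m|^(p-2) ⟨m, Z⟩ + c_p |Z|^p` (`le_sub_tangent`), in which `c_p` arises. For
general `η` a divided difference is an average of `ψ''` against a triangular density, `ψ''`
increases with the distance from its centre, and the density for `η` arises from that for `0` by an
expanding map (`exists_le_divided_difference`).

*Ground state representation.* Apply this with `a`, `b` the values of `ω` at the two points and
integrate. The terms with `c_p` give the weighted energy. The others are, up to the kernel,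
`|ω(x) - ω(y)|^(p-1)` times the difference of `|u|^p ω^(1-p)` at the two points. On the dilation
invariant cone `y_N < θ x_N`, `θ < 1`, the two parts can be integrated separately: the tangential
variables are integrated out with a Gamma integral (`lintegral_halfSpace_kernel`), and the
substitutions `y_N = r x_N` and `x_N = y_N / r` turn the rest into multiples of the Hardy term by
integrals over `0 < r < θ`, whose difference is that of the Hardy integrand
(`lintegral_crossDensity_fst`, `lintegral_crossDensity_snd`, `lowerMass_eq`, `upperMass_eq`).
Cancelling the smaller one, which is finite, and letting `θ → 1` gives
`E[u] = D H[u] + c_p W[v] + ρ` with `ρ ≥ 0` in `[0, ∞]`, and `ρ = 0` for `p = 2`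
(`exists_gagliardoEnergy_eq`). This holds for every measurable `u` with finite Hardy term `H[u]`.

*Completion.* Test functions have finite energy and Hardy term. As `D > 0`, the representation
bounds the Hardy terms along an approximating sequence by its energies, and Fatou's lemma shows that
`E[u]` and `H[u]` are finite for `u` in the completion (`MemW.exists_measurable`).
-/

/-! ### The function that defines the constant of the remainder -/

lemma continuous_remainderFun {p : ℝ} (hp : 2 ≤ p) : Continuous (remainderFun p) := by
  unfold remainderFun
  have h1 : Continuous fun τ : ℝ => (1 - τ) ^ p :=
    (continuous_const.sub continuous_id).rpow_const fun _ => Or.inr (by linarith)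
  have h2 : Continuous fun τ : ℝ => τ ^ p := continuous_id.rpow_const fun _ => Or.inr (by linarith)
  have h3 : Continuous fun τ : ℝ => τ ^ (p - 1) :=
    continuous_id.rpow_const fun _ => Or.inr (by linarith)
  exact (h1.sub h2).add (continuous_const.mul h3)

lemma remainderFun_two (τ : ℝ) : remainderFun 2 τ = 1 := by
  have h : (2 : ℝ) - 1 = 1 := by norm_num
  simp only [remainderFun, h, Real.rpow_one, Real.rpow_two]
  ring

lemma remainderFun_zero {p : ℝ} (hp : 2 ≤ p) : remainderFun p 0 = 1 := by
  simp [remainderFun, Real.zero_rpow (by linarith : p ≠ 0),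
    Real.zero_rpow (by linarith : p - 1 ≠ 0)]

lemma remainderFun_pos {p τ : ℝ} (hp : 2 ≤ p) (h0 : 0 < τ) (h1 : τ < 1 / 2) :
    0 < remainderFun p τ := by
  have h2 : τ ^ p < (1 - τ) ^ p := Real.rpow_lt_rpow h0.le (by linarith) (by linarith)
  have h3 : 0 < p * τ ^ (p - 1) := mul_pos (by linarith) (Real.rpow_pos_of_pos h0 _)
  unfold remainderFun
  linarith

lemma hasDerivAt_remainderFun {p : ℝ} (hp : 2 ≤ p) (τ : ℝ) :
    HasDerivAt (remainderFun p)
      (-(p * (1 - τ) ^ (p - 1)) - p * τ ^ (p - 1) + p * ((p - 1) * τ ^ (p - 1 - 1))) τ := by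
  have h1 : HasDerivAt (fun x : ℝ => (1 - x) ^ p) (-1 * p * (1 - τ) ^ (p - 1)) τ :=
    ((hasDerivAt_id τ).const_sub 1).rpow_const (Or.inr (by linarith))
  have h2 : HasDerivAt (fun x : ℝ => x ^ p) (p * τ ^ (p - 1)) τ :=
    Real.hasDerivAt_rpow_const (Or.inr (by linarith))
  have h3 : HasDerivAt (fun x : ℝ => x ^ (p - 1)) ((p - 1) * τ ^ (p - 1 - 1)) τ :=
    Real.hasDerivAt_rpow_const (Or.inr (by linarith))
  refine ((h1.sub h2).add (h3.const_mul p)).congr_deriv ?_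
  ring

/-- The minimum over the open interval is attained: for `p > 2` the function decreases at `0` and
increases at `1 / 2`, so its minimum over the closed interval is an interior one. -/
lemma exists_isLeast_remainderFun {p : ℝ} (hp : 2 ≤ p) :
    ∃ c : ℝ, IsLeast (remainderFun p '' Set.Ioo (0 : ℝ) (1 / 2)) c ∧ 0 < c ∧ c ≤ 1 ∧
      (p = 2 → c = 1) := by
  rcases hp.eq_or_lt with rfl | hp2
  · refine ⟨1, ⟨⟨1 / 4, by norm_num, remainderFun_two _⟩, ?_⟩, one_pos, le_rfl, fun _ => rfl⟩
    rintro _ ⟨τ, -, rfl⟩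
    rw [remainderFun_two]
  obtain ⟨τ, hτ, hmin⟩ := isCompact_Icc.exists_isMinOn (Set.nonempty_Icc.2 (by norm_num))
    (continuous_remainderFun hp).continuousOn (s := Set.Icc (0 : ℝ) (1 / 2))
  rw [isMinOn_iff] at hmin
  have hd0 := hasDerivAt_remainderFun hp 0
  have hdh := hasDerivAt_remainderFun hp (1 / 2)
  rw [Real.zero_rpow (by linarith), Real.zero_rpow (by linarith)] at hd0
  have hτ0 : τ ≠ 0 := by
    rintro rfl
    have h1 := (hd0.tendsto_slope.mono_left (nhdsGT_le_nhdsNE 0))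
    have h2 : ∀ᶠ x in 𝓝[>] (0 : ℝ), 0 ≤ slope (remainderFun p) 0 x := by
      filter_upwards [Ioo_mem_nhdsGT (show (0 : ℝ) < 1 / 2 by norm_num)] with x hx
      rw [slope_def_field]
      exact div_nonneg (sub_nonneg.2 (hmin x ⟨hx.1.le, hx.2.le⟩)) (by linarith [hx.1])
    have h3 := ge_of_tendsto h1 h2
    norm_num at h3
    linarith
  have hτh : τ ≠ 1 / 2 := by
    rintro rfl
    have h1 := (hdh.tendsto_slope.mono_left (nhdsLT_le_nhdsNE _))
    have h2 : ∀ᶠ x in 𝓝[<] (1 / 2 : ℝ), slope (remainderFun p) (1 / 2) x ≤ 0 := by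
      filter_upwards [Ioo_mem_nhdsLT (show (0 : ℝ) < 1 / 2 by norm_num)] with x hx
      rw [slope_def_field]
      exact div_nonpos_of_nonneg_of_nonpos (sub_nonneg.2 (hmin x ⟨hx.1.le, hx.2.le⟩))
        (by linarith [hx.2])
    have h3 := le_of_tendsto h1 h2
    have h4 : (1 / 2 : ℝ) ^ (p - 1 - 1) = 2 * (1 / 2) ^ (p - 1) := by
      rw [Real.rpow_sub (by norm_num) (p - 1), Real.rpow_one]
      ring
    rw [h4, show (1 - 1 / 2 : ℝ) = 1 / 2 by norm_num] at h3
    have h5 : (0 : ℝ) < (1 / 2) ^ (p - 1) := by positivity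
    nlinarith [mul_pos (mul_pos (by linarith : 0 < p) (by linarith : 0 < p - 2)) h5]
  have hτ' : τ ∈ Set.Ioo (0 : ℝ) (1 / 2) :=
    ⟨lt_of_le_of_ne hτ.1 (Ne.symm hτ0), lt_of_le_of_ne hτ.2 hτh⟩
  refine ⟨remainderFun p τ, ⟨⟨τ, hτ', rfl⟩, ?_⟩, remainderFun_pos hp hτ'.1 hτ'.2, ?_,
    fun h => absurd h hp2.ne'⟩
  · rintro _ ⟨x, hx, rfl⟩
    exact hmin x ⟨hx.1.le, hx.2.le⟩
  · rw [← remainderFun_zero hp]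
    exact hmin 0 ⟨le_rfl, by norm_num⟩

lemma le_remainderFun_half {p c : ℝ} (hp : 2 ≤ p)
    (hc : ∀ τ ∈ Set.Ioo (0 : ℝ) (1 / 2), c ≤ remainderFun p τ) : c ≤ remainderFun p (1 / 2) := by
  have h1 : Tendsto (remainderFun p) (𝓝[<] (1 / 2)) (𝓝 (remainderFun p (1 / 2))) :=
    (continuous_remainderFun hp).continuousWithinAt
  refine ge_of_tendsto h1 ?_
  filter_upwards [Ioo_mem_nhdsLT (show (0 : ℝ) < 1 / 2 by norm_num)] with x hx using hc x hx

/-! ### The pointwise inequality -/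

/-- The convex function `t ↦ t ^ q` lies above its tangent at `B`. -/
lemma rpow_tangent_le {A B q : ℝ} (hA : 0 ≤ A) (hB : 0 < B) (hq : 1 ≤ q) :
    B ^ q + q * B ^ (q - 1) * (A - B) ≤ A ^ q := by
  have h := one_add_mul_self_le_rpow_one_add (s := A / B - 1)
    (by have := div_nonneg hA hB.le; linarith) hq
  rw [add_sub_cancel, Real.div_rpow hA hB.le, le_div_iff₀ (Real.rpow_pos_of_pos hB q)] at h
  refine le_trans (le_of_eq ?_) h
  rw [Real.rpow_sub_one hB.ne']
  field_simp

/-- The inequality `|m + Z|^p ≥ |m|^p + p |m|^(p-2) ⟨m, Z⟩ + c |Z|^p` for `|Z| = 1`, in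
coordinates: `y` is the component of `m` along `Z` and `b` the distance of `m` to the line `ℝ Z`.
With `ρ = |m|`, it follows from the tangent to `t ^ (p/2)` at `ρ²` if `ρ ≥ 1/2`, and at `(1 - ρ)²`
if `ρ < 1/2`. -/
lemma le_sub_tangent {p c : ℝ} (hp : 2 ≤ p)
    (hc : ∀ τ ∈ Set.Ioo (0 : ℝ) (1 / 2), c ≤ remainderFun p τ) {b : ℝ} (hb : b ≠ 0) (y : ℝ) :
    c ≤ ((y + 1) ^ 2 + b ^ 2) ^ (p / 2) - (y ^ 2 + b ^ 2) ^ (p / 2)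
      - p * y * (y ^ 2 + b ^ 2) ^ (p / 2 - 1) := by
  have hpos : 0 < y ^ 2 + b ^ 2 := by positivity
  obtain ⟨ρ, hρ, hρ2⟩ : ∃ ρ : ℝ, 0 < ρ ∧ ρ ^ 2 = y ^ 2 + b ^ 2 :=
    ⟨√(y ^ 2 + b ^ 2), Real.sqrt_pos.2 hpos, Real.sq_sqrt hpos.le⟩
  have hyρ : -y ≤ ρ := by nlinarith [sq_nonneg b]
  have e1 : (ρ ^ 2) ^ (p / 2) = ρ ^ p := by
    rw [← Real.rpow_natCast_mul hρ.le]; congr 1; push_cast; ring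
  have e2 : (ρ ^ 2) ^ (p / 2 - 1) = ρ ^ (p - 2) := by
    rw [← Real.rpow_natCast_mul hρ.le]; congr 1; push_cast; ring
  have hA : (y + 1) ^ 2 + b ^ 2 = ρ ^ 2 + 2 * y + 1 := by rw [hρ2]; ring
  have hA0 : 0 ≤ ρ ^ 2 + 2 * y + 1 := by rw [← hA]; positivity
  rw [← hρ2, hA, e1, e2]
  rcases le_or_gt (1 / 2) ρ with h | h
  · have h1 := rpow_tangent_le hA0 (by positivity : 0 < ρ ^ 2) (by linarith : 1 ≤ p / 2)
    rw [e1, e2] at h1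
    have h2 : (1 / 2 : ℝ) ^ (p - 2) ≤ ρ ^ (p - 2) :=
      Real.rpow_le_rpow (by norm_num) h (by linarith)
    have h3 : remainderFun p (1 / 2) = p / 2 * (1 / 2) ^ (p - 2) := by
      unfold remainderFun
      rw [show p - 1 = (p - 2) + 1 by ring, Real.rpow_add_one (by norm_num),
        show (1 - 1 / 2 : ℝ) = 1 / 2 by norm_num]
      ring
    have h4 := le_remainderFun_half hp hc
    rw [h3] at h4
    nlinarith
  · have h0 : 0 < 1 - ρ := by linarith
    have e3 : ((1 - ρ) ^ 2) ^ (p / 2) = (1 - ρ) ^ p := by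
      rw [← Real.rpow_natCast_mul h0.le]; congr 1; push_cast; ring
    have e4 : ((1 - ρ) ^ 2) ^ (p / 2 - 1) = (1 - ρ) ^ (p - 2) := by
      rw [← Real.rpow_natCast_mul h0.le]; congr 1; push_cast; ring
    have h1 := rpow_tangent_le hA0 (by positivity : 0 < (1 - ρ) ^ 2) (by linarith : 1 ≤ p / 2)
    rw [e3, e4] at h1
    have h2 : ρ ^ (p - 2) ≤ (1 - ρ) ^ (p - 2) :=
      Real.rpow_le_rpow hρ.le (by linarith) (by linarith)
    have h3 := hc ρ ⟨hρ, h⟩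
    have h4 : ρ ^ (p - 1) = ρ ^ (p - 2) * ρ := by
      rw [show p - 1 = (p - 2) + 1 by ring, Real.rpow_add_one hρ.ne']
    unfold remainderFun at h3
    rw [h4] at h3
    have h5 : 0 ≤ p * (y + ρ) := mul_nonneg (by linarith) (by linarith)
    nlinarith [mul_le_mul_of_nonneg_left h2 h5]

/-- If `ψ''` is even and increasing in `|x|` (`hmono`), then every second divided difference of `ψ`
at nodes `x - η, x + η, x + k` with `k² = 1 + η²` dominates one at nodes `y, y, y + 1`. Both are
averages of `ψ''` against triangular densities; near the right-hand node the two densities have the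
same slope, and the monotone map carrying one to the other is expanding, so that `y` can be
chosen with the zero of `|x|` matched by this map. In the proof `d = k - η = 1 / (k + η)`, and the
expanding map is `p₁ - √(1 - κ s²) ↦ x - η + s` on the part to the left of the node `x + η` and a
translation on the part to the right. -/
lemma exists_le_divided_difference {ψ ψ' ψ'' : ℝ → ℝ} (h1 : ∀ x, HasDerivAt ψ (ψ' x) x)
    (h2 : ∀ x, HasDerivAt ψ' (ψ'' x) x) (hcont : Continuous ψ'')
    (hmono : ∀ x y, |x| ≤ |y| → ψ'' x ≤ ψ'' y) {η k : ℝ} (hη : 0 < η) (hk : 0 < k)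
    (hkη : k ^ 2 = 1 + η ^ 2) (x : ℝ) :
    ∃ y, ψ (y + 1) - ψ y - ψ' y ≤
      ψ (x + k) - (k + η) / (2 * η) * ψ (x + η) + (k - η) / (2 * η) * ψ (x - η) := by
  obtain ⟨d, hd⟩ : ∃ d, d = k - η := ⟨_, rfl⟩
  have hdK : d * (k + η) = 1 := by rw [hd]; linarith [sq_nonneg k]
  have hd0 : 0 < d := by nlinarith
  obtain ⟨κ, hκ⟩ : ∃ κ, κ = d / (2 * η) := ⟨_, rfl⟩
  have hκ0 : 0 < κ := by rw [hκ]; positivity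
  have hκη : κ * (2 * η) = d := by rw [hκ]; field_simp
  have hkd : k = d + η := by rw [hd]; ring
  have hd2 : d ^ 2 + 2 * η * d = 1 := by rw [hkd] at hdK; linarith
  have hlow : ∀ s ∈ Set.Icc 0 (2 * η), d ^ 2 ≤ 1 - κ * s ^ 2 := by
    intro s hs
    have : κ * s ^ 2 ≤ κ * (2 * η) ^ 2 :=
      mul_le_mul_of_nonneg_left (pow_le_pow_left₀ hs.1 hs.2 2) hκ0.le
    have h3 : κ * (2 * η) ^ 2 = 2 * η * d := by rw [sq, ← mul_assoc, hκη]; ring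
    linarith
  have hrd : ∀ s ∈ Set.Icc 0 (2 * η), d ≤ √(1 - κ * s ^ 2) := fun s hs =>
    Real.le_sqrt_of_sq_le (hlow s hs)
  have hr2 : ∀ s ∈ Set.Icc 0 (2 * η), √(1 - κ * s ^ 2) ^ 2 = 1 - κ * s ^ 2 := fun s hs =>
    Real.sq_sqrt ((sq_nonneg d).trans (hlow s hs))
  have hκs : ∀ s ∈ Set.Icc 0 (2 * η), κ * s ≤ √(1 - κ * s ^ 2) := fun s hs =>
    ((mul_le_mul_of_nonneg_left hs.2 hκ0.le).trans hκη.le).trans (hrd s hs)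
  have hlip : ∀ s ∈ Set.Icc 0 (2 * η), ∀ t ∈ Set.Icc 0 (2 * η),
      |√(1 - κ * s ^ 2) - √(1 - κ * t ^ 2)| ≤ |s - t| := by
    intro s hs t ht
    have hp : 0 < √(1 - κ * s ^ 2) + √(1 - κ * t ^ 2) := by linarith [hrd s hs, hrd t ht]
    refine le_of_mul_le_mul_right ?_ hp
    have e : (√(1 - κ * s ^ 2) - √(1 - κ * t ^ 2)) * (√(1 - κ * s ^ 2) + √(1 - κ * t ^ 2))
        = (t - s) * (κ * s + κ * t) := by
      have := hr2 s hs
      have := hr2 t ht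
      nlinarith
    calc |√(1 - κ * s ^ 2) - √(1 - κ * t ^ 2)| * (√(1 - κ * s ^ 2) + √(1 - κ * t ^ 2))
        = |(t - s) * (κ * s + κ * t)| := by rw [← e, abs_mul, abs_of_pos hp]
      _ = |s - t| * (κ * s + κ * t) := by
        rw [abs_mul, abs_sub_comm, abs_of_nonneg (a := κ * s + κ * t)]
        have := mul_nonneg hκ0.le hs.1
        have := mul_nonneg hκ0.le ht.1
        linarith
      _ ≤ _ := mul_le_mul_of_nonneg_left (add_le_add (hκs s hs) (hκs t ht)) (abs_nonneg _)
  have hKs : ∀ s ∈ Set.Icc 0 (2 * η), √(1 - κ * s ^ 2) ≤ k + η - s := by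
    intro s hs
    refine Real.sqrt_le_iff.2 ⟨by linarith [hs.2, hkd], ?_⟩
    have h4 : κ * (k + η) * (2 * η) = 1 := by
      rw [mul_right_comm, hκη, hdK]
    have h5 : (k + η - s) ^ 2 - (1 - κ * s ^ 2) = (1 + κ) * (2 * η - s) ^ 2 := by
      have h6 : k + η = 2 * η * (1 + κ) := by rw [mul_add, mul_comm _ κ, hκη, hkd]; ring
      have h7 : (k + η) ^ 2 = 1 + 2 * η * (k + η) := by nlinarith
      have h8 : (2 * η) * (1 + κ) * (2 * η) = 2 * η * (k + η) := by rw [← h6]; ring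
      nlinarith
    have : 0 ≤ (1 + κ) * (2 * η - s) ^ 2 := by positivity
    linarith
  -- the matched position of the right-hand node
  obtain ⟨p₁, hA, hB⟩ : ∃ p₁ : ℝ, (∀ v ∈ Set.Icc 0 d, |p₁ - v| ≤ |x + k - v|) ∧
      ∀ s ∈ Set.Icc 0 (2 * η), |p₁ - √(1 - κ * s ^ 2)| ≤ |x - η + s| := by
    rcases le_or_gt (x + η) 0 with hx | hx
    · refine ⟨x + k, fun _ _ => le_rfl, fun s hs => ?_⟩
      rw [abs_of_nonpos (a := x - η + s) (by linarith [hs.2]), abs_le]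
      constructor
      · linarith [hKs s hs]
      · linarith [hrd s hs, hs.2]
    rcases le_or_gt (x - η) 0 with hx' | hx'
    · have hs0 : η - x ∈ Set.Icc 0 (2 * η) := ⟨by linarith, by linarith⟩
      refine ⟨√(1 - κ * (η - x) ^ 2), fun v hv => ?_, fun s hs => ?_⟩
      · have h3 := hrd _ hs0
        have h4 := hKs _ hs0
        rw [abs_of_nonneg (by linarith [hv.2]), abs_of_nonneg (by linarith [hv.2])]
        linarith
      · refine (hlip _ hs0 s hs).trans (le_of_eq ?_)
        rw [abs_sub_comm]
        congr 1
        ring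
    · have hs0 : (0 : ℝ) ∈ Set.Icc 0 (2 * η) := ⟨le_rfl, by linarith⟩
      have h3 := hrd _ hs0
      have h4 := hKs _ hs0
      simp only [ne_eq, OfNat.ofNat_ne_zero, not_false_eq_true, zero_pow, mul_zero, sub_zero,
        Real.sqrt_one] at h3 h4
      refine ⟨1, fun v hv => ?_, fun s hs => ?_⟩
      · rw [abs_of_nonneg (by linarith [hv.2]), abs_of_nonneg (by linarith [hv.2])]
        linarith
      · have h5 := hlip _ hs0 s hs
        simp only [ne_eq, OfNat.ofNat_ne_zero, not_false_eq_true, zero_pow, mul_zero, sub_zero,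
          Real.sqrt_one, zero_sub, abs_neg] at h5
        refine h5.trans ?_
        rw [abs_of_nonneg hs.1, abs_of_nonneg (by linarith [hs.1])]
        linarith
  have hG : ∀ q v : ℝ, HasDerivAt (fun v => -v * ψ' (q - v) - ψ (q - v)) (v * ψ'' (q - v)) v := by
    intro q v
    have e1 : HasDerivAt (fun v => q - v) (-1) v := (hasDerivAt_id v).const_sub q
    refine ((((hasDerivAt_id v).neg).mul ((h2 (q - v)).comp v e1)).sub
      ((h1 (q - v)).comp v e1)).congr_deriv ?_
    simp
  have hH : ∀ s : ℝ, HasDerivAt (fun s => s * ψ' (x - η + s) - ψ (x - η + s))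
      (s * ψ'' (x - η + s)) s := by
    intro s
    have e1 : HasDerivAt (fun s => x - η + s) 1 s := (hasDerivAt_id s).const_add _
    refine (((hasDerivAt_id s).mul ((h2 _).comp s e1)).sub ((h1 _).comp s e1)).congr_deriv ?_
    simp
  have hR : ∀ s ∈ Set.Icc 0 (2 * η), HasDerivAt
      (fun s => -(-√(1 - κ * s ^ 2) * ψ' (p₁ - √(1 - κ * s ^ 2)) - ψ (p₁ - √(1 - κ * s ^ 2))))
      (κ * (s * ψ'' (p₁ - √(1 - κ * s ^ 2)))) s := by
    intro s hs
    have hr0 : 0 < √(1 - κ * s ^ 2) := hd0.trans_le (hrd s hs)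
    have e1 : HasDerivAt (fun s : ℝ => 1 - κ * s ^ 2) (-(κ * (2 * s))) s := by
      refine (((hasDerivAt_pow 2 s).const_mul κ).const_sub 1).congr_deriv ?_
      simp
    have e2 := e1.sqrt (Real.sqrt_pos.1 hr0).ne'
    refine (((hG p₁ _).comp s e2).neg).congr_deriv ?_
    field_simp
  have hI : ∀ q : ℝ, Continuous fun v => v * ψ'' (q - v) := fun q => by fun_prop
  have hI2 : Continuous fun s => κ * (s * ψ'' (x - η + s)) := by fun_prop
  have hI3 : Continuous fun s => κ * (s * ψ'' (p₁ - √(1 - κ * s ^ 2))) := by fun_prop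
  have i1 : ∀ q, ∫ v in (0 : ℝ)..d, v * ψ'' (q - v)
      = (-d * ψ' (q - d) - ψ (q - d)) - (-0 * ψ' (q - 0) - ψ (q - 0)) := fun q =>
    intervalIntegral.integral_eq_sub_of_hasDerivAt (fun v _ => hG q v)
      ((hI q).intervalIntegrable _ _)
  have i2 := intervalIntegral.integral_eq_sub_of_hasDerivAt (a := 0) (b := 2 * η)
    (fun s _ => (hH s).const_mul κ) (hI2.intervalIntegrable _ _)
  have i3 := intervalIntegral.integral_eq_sub_of_hasDerivAt (a := 0) (b := 2 * η)
    (fun s hs => hR s (by rwa [Set.uIcc_of_le (by linarith)] at hs)) (hI3.intervalIntegrable _ _)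
  have c1 : ∫ v in (0 : ℝ)..d, v * ψ'' (p₁ - v) ≤ ∫ v in (0 : ℝ)..d, v * ψ'' (x + k - v) :=
    intervalIntegral.integral_mono_on hd0.le ((hI _).intervalIntegrable _ _)
      ((hI _).intervalIntegrable _ _)
      fun v hv => mul_le_mul_of_nonneg_left (hmono _ _ (hA v hv)) hv.1
  have c2 : ∫ s in (0 : ℝ)..(2 * η), κ * (s * ψ'' (p₁ - √(1 - κ * s ^ 2)))
      ≤ ∫ s in (0 : ℝ)..(2 * η), κ * (s * ψ'' (x - η + s)) :=
    intervalIntegral.integral_mono_on (by linarith) (hI3.intervalIntegrable _ _)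
      (hI2.intervalIntegrable _ _)
      fun s hs => mul_le_mul_of_nonneg_left
        (mul_le_mul_of_nonneg_left (hmono _ _ (hB s hs)) hs.1) hκ0.le
  have hend : √(1 - κ * (2 * η) ^ 2) = d := by
    rw [show 1 - κ * (2 * η) ^ 2 = d ^ 2 by rw [sq (2 * η), ← mul_assoc, hκη]; linarith]
    exact Real.sqrt_sq hd0.le
  rw [i1, i1] at c1
  rw [i2, i3, hend] at c2
  refine ⟨p₁ - 1, ?_⟩
  have e1 : x - η + 2 * η = x + η := by ring
  have e2 : x + k - d = x + η := by rw [hkd]; ring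
  have e3 : (k + η) / (2 * η) = 1 + κ := by rw [hκ, hkd]; field_simp; ring
  rw [e1] at c2
  rw [e2] at c1
  rw [e3, ← hd, ← hκ]
  simp only [ne_eq, OfNat.ofNat_ne_zero, not_false_eq_true, zero_pow, mul_zero, sub_zero,
    Real.sqrt_one, zero_mul, neg_zero, zero_sub, add_zero, mul_sub, ← mul_assoc, hκη,
    sub_add_cancel] at c1 c2 ⊢
  linarith

/-- The second derivative of `(x² + b²) ^ (p/2)` is increasing in `|x|` for `p ≥ 2`. -/
lemma second_deriv_mono {p b : ℝ} (hp : 2 ≤ p) (hb : b ≠ 0) {x y : ℝ} (h : |x| ≤ |y|) :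
    p * (x ^ 2 + b ^ 2) ^ (p / 2 - 1) + p * (p - 2) * x ^ 2 * (x ^ 2 + b ^ 2) ^ (p / 2 - 1 - 1) ≤
    p * (y ^ 2 + b ^ 2) ^ (p / 2 - 1) +
      p * (p - 2) * y ^ 2 * (y ^ 2 + b ^ 2) ^ (p / 2 - 1 - 1) := by
  have hxy : x ^ 2 ≤ y ^ 2 := sq_le_sq.2 h
  have hX : 0 < x ^ 2 + b ^ 2 := by positivity
  have hY : 0 < y ^ 2 + b ^ 2 := by positivity
  -- the second summand is a multiple of `(x² / (x² + b²)) (x² + b²) ^ (p/2 - 1)`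
  have e : ∀ z : ℝ, 0 < z ^ 2 + b ^ 2 →
      p * (z ^ 2 + b ^ 2) ^ (p / 2 - 1) + p * (p - 2) * z ^ 2 * (z ^ 2 + b ^ 2) ^ (p / 2 - 1 - 1)
        = p * (z ^ 2 + b ^ 2) ^ (p / 2 - 1) * (1 + (p - 2) * (z ^ 2 / (z ^ 2 + b ^ 2))) := by
    intro z hz
    rw [Real.rpow_sub_one hz.ne' (p / 2 - 1)]
    ring
  rw [e x hX, e y hY]
  have h1 : (x ^ 2 + b ^ 2) ^ (p / 2 - 1) ≤ (y ^ 2 + b ^ 2) ^ (p / 2 - 1) :=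
    Real.rpow_le_rpow hX.le (by linarith) (by linarith)
  have h2 : x ^ 2 / (x ^ 2 + b ^ 2) ≤ y ^ 2 / (y ^ 2 + b ^ 2) := by
    rw [div_le_div_iff₀ hX hY]
    nlinarith [sq_nonneg b]
  have h3 : 0 ≤ x ^ 2 / (x ^ 2 + b ^ 2) := by positivity
  have hp2 : 0 ≤ p - 2 := by linarith
  have h4 : 1 + (p - 2) * (x ^ 2 / (x ^ 2 + b ^ 2)) ≤ 1 + (p - 2) * (y ^ 2 / (y ^ 2 + b ^ 2)) := by
    linarith [mul_le_mul_of_nonneg_left h2 hp2]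
  have h5 : 0 ≤ 1 + (p - 2) * (x ^ 2 / (x ^ 2 + b ^ 2)) := by positivity
  have hp0 : 0 ≤ p := by linarith
  exact mul_le_mul (mul_le_mul_of_nonneg_left h1 hp0) h4 h5 (by positivity)

lemma le_divided_difference_of_ne {p c : ℝ} (hp : 2 ≤ p)
    (hc : ∀ τ ∈ Set.Ioo (0 : ℝ) (1 / 2), c ≤ remainderFun p τ) {η k : ℝ} (hη : 0 < η) (hk : 0 < k)
    (hkη : k ^ 2 = 1 + η ^ 2) (x : ℝ) {b : ℝ} (hb : b ≠ 0) :
    c ≤ ((x + k) ^ 2 + b ^ 2) ^ (p / 2) - (k + η) / (2 * η) * ((x + η) ^ 2 + b ^ 2) ^ (p / 2)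
      + (k - η) / (2 * η) * ((x - η) ^ 2 + b ^ 2) ^ (p / 2) := by
  have hpos : ∀ z : ℝ, 0 < z ^ 2 + b ^ 2 := fun z => by positivity
  have hd : ∀ z : ℝ, HasDerivAt (fun z : ℝ => z ^ 2 + b ^ 2) (2 * z) z := fun z => by
    simpa using (hasDerivAt_pow 2 z).add_const (b ^ 2)
  have h1 : ∀ z : ℝ, HasDerivAt (fun z : ℝ => (z ^ 2 + b ^ 2) ^ (p / 2))
      (p * z * (z ^ 2 + b ^ 2) ^ (p / 2 - 1)) z := fun z =>
    ((hd z).rpow_const (Or.inl (hpos z).ne')).congr_deriv (by ring)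
  have h2 : ∀ z : ℝ, HasDerivAt (fun z : ℝ => p * z * (z ^ 2 + b ^ 2) ^ (p / 2 - 1))
      (p * (z ^ 2 + b ^ 2) ^ (p / 2 - 1) +
        p * (p - 2) * z ^ 2 * (z ^ 2 + b ^ 2) ^ (p / 2 - 1 - 1)) z := fun z =>
    (((hasDerivAt_id z).const_mul p).mul
      ((hd z).rpow_const (p := p / 2 - 1) (Or.inl (hpos z).ne'))).congr_deriv (by simp; ring)
  have hcont : Continuous fun z : ℝ => p * (z ^ 2 + b ^ 2) ^ (p / 2 - 1) +
      p * (p - 2) * z ^ 2 * (z ^ 2 + b ^ 2) ^ (p / 2 - 1 - 1) := by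
    have h : ∀ q : ℝ, Continuous fun z : ℝ => (z ^ 2 + b ^ 2) ^ q := fun q =>
      Continuous.rpow_const (by fun_prop) fun z => Or.inl (hpos z).ne'
    have := h (p / 2 - 1)
    have := h (p / 2 - 1 - 1)
    fun_prop
  obtain ⟨y, hy⟩ := exists_le_divided_difference h1 h2 hcont
    (fun _ _ h => second_deriv_mono hp hb h) hη hk hkη x
  exact (le_sub_tangent hp hc hb y).trans hy

lemma le_divided_difference {p c : ℝ} (hp : 2 ≤ p)
    (hc : ∀ τ ∈ Set.Ioo (0 : ℝ) (1 / 2), c ≤ remainderFun p τ) {η k : ℝ} (hη : 0 < η) (hk : 0 < k)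
    (hkη : k ^ 2 = 1 + η ^ 2) (x b : ℝ) :
    c ≤ ((x + k) ^ 2 + b ^ 2) ^ (p / 2) - (k + η) / (2 * η) * ((x + η) ^ 2 + b ^ 2) ^ (p / 2)
      + (k - η) / (2 * η) * ((x - η) ^ 2 + b ^ 2) ^ (p / 2) := by
  have hq : ∀ z : ℝ, Continuous fun b : ℝ => (z ^ 2 + b ^ 2) ^ (p / 2) := fun z =>
    Continuous.rpow_const (by fun_prop) fun _ => Or.inr (by linarith)
  have hcont : Continuous fun b : ℝ => ((x + k) ^ 2 + b ^ 2) ^ (p / 2)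
      - (k + η) / (2 * η) * ((x + η) ^ 2 + b ^ 2) ^ (p / 2)
      + (k - η) / (2 * η) * ((x - η) ^ 2 + b ^ 2) ^ (p / 2) := by
    have := hq (x + k)
    have := hq (x + η)
    have := hq (x - η)
    fun_prop
  have hdense : Dense {b : ℝ | b ≠ 0} := dense_compl_singleton 0
  exact (isClosed_le continuous_const hcont).closure_subset_iff.2
    (fun b hb => le_divided_difference_of_ne hp hc hη hk hkη x hb) (hdense.closure_eq ▸ trivial)

section Vector

variable {E : Type*} [NormedAddCommGroup E] [InnerProductSpace ℝ E]

/-- The pointwise inequality behind the ground state representation, for weights with product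
one. -/
lemma norm_sub_rpow_ge_of_mul_eq_one {p c : ℝ} (hp : 2 ≤ p) (hc1 : c ≤ 1)
    (hc : ∀ τ ∈ Set.Ioo (0 : ℝ) (1 / 2), c ≤ remainderFun p τ) {a b : ℝ} (hb : 0 < b)
    (hba : b ≤ a) (hab : a * b = 1) (X Y : E) :
    (a - b) ^ (p - 1) * (a * ‖X‖ ^ p - b * ‖Y‖ ^ p) + c * ‖X - Y‖ ^ p ≤ ‖a • X - b • Y‖ ^ p := by
  rcases hba.eq_or_lt with rfl | hlt
  · obtain rfl : b = 1 := by nlinarith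
    rw [sub_self, Real.zero_rpow (by linarith), one_smul, one_smul, zero_mul, zero_add]
    exact mul_le_of_le_one_left (by positivity) hc1
  have hs : 0 < a - b := sub_pos.2 hlt
  have hpow : (a - b) ^ (p - 1) * (a - b) = (a - b) ^ p := by
    rw [← Real.rpow_add_one hs.ne', sub_add_cancel]
  rcases eq_or_ne X Y with rfl | hne
  · rw [sub_self, norm_zero, Real.zero_rpow (by linarith), ← sub_smul, norm_smul,
      Real.norm_of_nonneg hs.le, Real.mul_rpow hs.le (norm_nonneg _), ← hpow]
    linarith
  obtain ⟨Z, hZ⟩ : ∃ Z, Z = X - Y := ⟨_, rfl⟩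
  have hZ0 : 0 < ‖Z‖ := by rw [hZ, norm_pos_iff, sub_ne_zero]; exact hne
  obtain ⟨m, hm⟩ : ∃ m, m = ((a - b) / 2) • (X + Y) := ⟨_, rfl⟩
  obtain ⟨α, hα⟩ : ∃ α, α = inner ℝ m Z / ‖Z‖ ^ 2 := ⟨_, rfl⟩
  obtain ⟨β, hβ⟩ : ∃ β, β = √(‖m‖ ^ 2 / ‖Z‖ ^ 2 - α ^ 2) := ⟨_, rfl⟩
  have hβ2 : β ^ 2 = ‖m‖ ^ 2 / ‖Z‖ ^ 2 - α ^ 2 := by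
    rw [hβ]
    refine Real.sq_sqrt ?_
    have h1 := abs_real_inner_le_norm m Z
    have h2 : (inner ℝ m Z) ^ 2 ≤ (‖m‖ * ‖Z‖) ^ 2 := sq_le_sq' (abs_le.1 h1).1 (abs_le.1 h1).2
    rw [hα, div_pow, sub_nonneg, div_le_div_iff₀ (by positivity) (by positivity)]
    nlinarith [sq_nonneg ‖Z‖]
  have hnorm : ∀ t : ℝ, ‖m + t • Z‖ ^ p = ‖Z‖ ^ p * ((α + t) ^ 2 + β ^ 2) ^ (p / 2) := by
    intro t
    have h1 : ‖m + t • Z‖ ^ 2 = ‖Z‖ ^ 2 * ((α + t) ^ 2 + β ^ 2) := by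
      rw [norm_add_sq_real, inner_smul_right, norm_smul, mul_pow, Real.norm_eq_abs, sq_abs, hβ2,
        show (inner ℝ m Z : ℝ) = α * ‖Z‖ ^ 2 by rw [hα]; field_simp]
      field_simp
      ring
    have h2 : ∀ r : ℝ, 0 ≤ r → r ^ p = (r ^ 2) ^ (p / 2) := fun r hr => by
      rw [← Real.rpow_natCast_mul hr]; congr 1; push_cast; ring
    rw [h2 _ (norm_nonneg _), h1, Real.mul_rpow (by positivity) (by positivity),
      ← h2 _ (norm_nonneg _)]
  have hk2 : ((a + b) / 2) ^ 2 = 1 + ((a - b) / 2) ^ 2 := by rw [← hab]; ring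
  have key := le_divided_difference hp hc (by linarith : 0 < (a - b) / 2)
    (by linarith : 0 < (a + b) / 2) hk2 α β
  have e1 : m + ((a + b) / 2) • Z = a • X - b • Y := by rw [hm, hZ]; module
  have e2 : m + ((a - b) / 2) • Z = (a - b) • X := by rw [hm, hZ]; module
  have e3 : m + (-((a - b) / 2)) • Z = (a - b) • Y := by rw [hm, hZ]; module
  have n1 := hnorm ((a + b) / 2)
  have n2 := hnorm ((a - b) / 2)
  have n3 := hnorm (-((a - b) / 2))
  rw [e1] at n1
  rw [e2, norm_smul, Real.norm_of_nonneg hs.le, Real.mul_rpow hs.le (norm_nonneg _)] at n2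
  rw [e3, norm_smul, Real.norm_of_nonneg hs.le, Real.mul_rpow hs.le (norm_nonneg _),
    ← sub_eq_add_neg] at n3
  have hZp : 0 < ‖Z‖ ^ p := Real.rpow_pos_of_pos hZ0 p
  have k2 := mul_le_mul_of_nonneg_left key hZp.le
  rw [← hZ, n1]
  have f1 : (a + b) / 2 + (a - b) / 2 = a := by ring
  have f2 : (a + b) / 2 - (a - b) / 2 = b := by ring
  have f3 : 2 * ((a - b) / 2) = a - b := by ring
  rw [f1, f2, f3] at k2
  have g2 : ‖Z‖ ^ p * (a / (a - b) * ((α + (a - b) / 2) ^ 2 + β ^ 2) ^ (p / 2))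
      = (a - b) ^ (p - 1) * (a * ‖X‖ ^ p) := by
    rw [mul_left_comm, ← n2, ← hpow]; field_simp
  have g3 : ‖Z‖ ^ p * (b / (a - b) * ((α - (a - b) / 2) ^ 2 + β ^ 2) ^ (p / 2))
      = (a - b) ^ (p - 1) * (b * ‖Y‖ ^ p) := by
    rw [mul_left_comm, ← n3, ← hpow]; field_simp
  rw [mul_add, mul_sub, g2, g3] at k2
  linarith

/-- The pointwise inequality behind the ground state representation. -/
lemma norm_smul_sub_smul_rpow_ge {p c : ℝ} (hp : 2 ≤ p) (hc1 : c ≤ 1)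
    (hc : ∀ τ ∈ Set.Ioo (0 : ℝ) (1 / 2), c ≤ remainderFun p τ) {a b : ℝ} (hb : 0 < b)
    (hba : b ≤ a) (X Y : E) :
    (a - b) ^ (p - 1) * (a * ‖X‖ ^ p - b * ‖Y‖ ^ p) + c * ((a * b) ^ (p / 2) * ‖X - Y‖ ^ p)
      ≤ ‖a • X - b • Y‖ ^ p := by
  have ha : 0 < a := hb.trans_le hba
  obtain ⟨G, hG⟩ : ∃ G, G = √(a * b) := ⟨_, rfl⟩
  have hG0 : 0 < G := by rw [hG]; positivity
  have hG2 : G ^ 2 = a * b := by rw [hG]; exact Real.sq_sqrt (by positivity)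
  have h := norm_sub_rpow_ge_of_mul_eq_one hp hc1 hc (div_pos hb hG0)
    (div_le_div_of_nonneg_right hba hG0.le)
    (by rw [div_mul_div_comm, ← sq, hG2, div_self (by positivity)]) X Y
  have hGp : 0 < G ^ p := Real.rpow_pos_of_pos hG0 p
  have h' := mul_le_mul_of_nonneg_left h hGp.le
  have e1 : G ^ p * ‖(a / G) • X - (b / G) • Y‖ ^ p = ‖a • X - b • Y‖ ^ p := by
    rw [← Real.mul_rpow hG0.le (norm_nonneg _), ← Real.norm_of_nonneg hG0.le, ← norm_smul,
      smul_sub, smul_smul, smul_smul, Real.norm_of_nonneg hG0.le, mul_div_cancel₀ _ hG0.ne',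
      mul_div_cancel₀ _ hG0.ne']
  have e2 : (a * b) ^ (p / 2) = G ^ p := by
    rw [← hG2, ← Real.rpow_natCast_mul hG0.le]; congr 1; push_cast; ring
  have e3 : G ^ p * (a / G - b / G) ^ (p - 1) = G * (a - b) ^ (p - 1) := by
    rw [← sub_div, Real.div_rpow (by linarith) hG0.le, Real.rpow_sub_one hG0.ne' p]
    field_simp
  rw [e1] at h'
  rw [e2]
  refine le_trans (le_of_eq ?_) h'
  rw [mul_add, ← mul_assoc (G ^ p), e3]
  field_simp

lemma norm_smul_sub_smul_sq (a b : ℝ) (X Y : E) :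
    ‖a • X - b • Y‖ ^ 2 = (a - b) * (a * ‖X‖ ^ 2 - b * ‖Y‖ ^ 2) + a * b * ‖X - Y‖ ^ 2 := by
  rw [norm_sub_sq_real, norm_sub_sq_real, norm_smul, norm_smul, inner_smul_left, inner_smul_right,
    mul_pow, mul_pow, Real.norm_eq_abs, Real.norm_eq_abs, sq_abs, sq_abs]
  simp
  ring

end Vector

/-! ### One-dimensional integrals -/

lemma abs_one_sub_rpow_le {β r : ℝ} (h1 : -1 ≤ β) (h2 : β ≤ 1) (hr0 : 0 < r) (hr1 : r < 1) :
    |1 - r ^ β| ≤ (1 - r) * r ^ min β 0 := by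
  rcases le_or_gt 0 β with h | h
  · have e1 : r ^ β ≤ 1 := Real.rpow_le_one hr0.le hr1.le h
    have e2 : r ^ (1 : ℝ) ≤ r ^ β := Real.rpow_le_rpow_of_exponent_ge hr0 hr1.le h2
    rw [Real.rpow_one] at e2
    rw [min_eq_right h, Real.rpow_zero, mul_one, abs_of_nonneg (by linarith)]
    linarith
  · have e1 : 1 ≤ r ^ β := Real.one_le_rpow_of_pos_of_le_one_of_nonpos hr0 hr1.le h.le
    have e2 : r ^ (1 : ℝ) ≤ r ^ (-β) :=
      Real.rpow_le_rpow_of_exponent_ge hr0 hr1.le (by linarith)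
    have e3 : r ^ β * r ^ (-β) = 1 := by rw [← Real.rpow_add hr0]; simp
    have e4 : 0 < r ^ β := Real.rpow_pos_of_pos hr0 _
    rw [Real.rpow_one] at e2
    rw [min_eq_left h.le, abs_of_nonpos (by linarith)]
    nlinarith

lemma hardyIntegrand_nonneg {p s r : ℝ} (hr1 : r ≤ 1) : 0 ≤ hardyIntegrand p s r :=
  div_nonneg (by positivity) (Real.rpow_nonneg (by linarith) _)

lemma hardyIntegrand_pos {p s r : ℝ} (hp : 2 ≤ p) (hps : p * s ≠ 1) (hr0 : 0 < r) (hr1 : r < 1) :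
    0 < hardyIntegrand p s r := by
  refine div_pos (Real.rpow_pos_of_pos (abs_pos.2 ?_) _) (Real.rpow_pos_of_pos (by linarith) _)
  have h : (p * s - 1) / p ≠ 0 := div_ne_zero (sub_ne_zero.2 hps) (by linarith)
  rw [sub_ne_zero]
  rcases h.lt_or_gt with h | h
  · exact (Real.one_lt_rpow_of_pos_of_lt_one_of_neg hr0 hr1 h).ne
  · exact (Real.rpow_lt_one hr0.le hr1 h).ne'

lemma measurable_hardyIntegrand (p s : ℝ) : Measurable (hardyIntegrand p s) := by
  unfold hardyIntegrand
  fun_prop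

lemma hardyExponent_mem {p s : ℝ} (hp : 2 ≤ p) (hs0 : 0 < s) (hs1 : s < 1) :
    -1 ≤ (p * s - 1) / p ∧ (p * s - 1) / p ≤ 1 := by
  have hp0 : 0 < p := by linarith
  rw [le_div_iff₀ hp0, div_le_iff₀ hp0]
  constructor <;> nlinarith

/-- The Hardy integrand is dominated by an Euler beta integrand. -/
lemma intervalIntegrable_hardyIntegrand {p s : ℝ} (hp : 2 ≤ p) (hs0 : 0 < s) (hs1 : s < 1) :
    IntervalIntegrable (hardyIntegrand p s) volume 0 1 := by
  have hp0 : 0 < p := by linarith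
  obtain ⟨h1, h2⟩ := hardyExponent_mem hp hs0 hs1
  obtain ⟨u, hu⟩ : ∃ u, u = min ((p * s - 1) / p) 0 * p + 1 := ⟨_, rfl⟩
  have hu0 : 0 < u := by
    rw [hu, min_mul_of_nonneg _ _ hp0.le, div_mul_cancel₀ _ hp0.ne', ← min_add_add_right]
    exact lt_min (by nlinarith) (by norm_num)
  have hv0 : 0 < p * (1 - s) := mul_pos hp0 (by linarith)
  have hbeta := (Complex.betaIntegral_convergent (u := (u : ℂ)) (v := ((p * (1 - s) : ℝ) : ℂ))
    (by simpa using hu0) (by simpa using hv0)).norm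
  rw [intervalIntegrable_iff_integrableOn_Ioo_of_le zero_le_one] at hbeta ⊢
  refine Integrable.mono' hbeta (measurable_hardyIntegrand p s).aestronglyMeasurable ?_
  refine (ae_restrict_iff' measurableSet_Ioo).2 (Eventually.of_forall fun r hr => ?_)
  have hr1 : 0 < 1 - r := by linarith [hr.2]
  rw [Real.norm_of_nonneg (hardyIntegrand_nonneg hr.2.le), norm_mul,
    Complex.norm_cpow_eq_rpow_re_of_pos hr.1,
    show (1 - (r : ℂ)) = ((1 - r : ℝ) : ℂ) by push_cast; rfl,
    Complex.norm_cpow_eq_rpow_re_of_pos hr1]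
  simp only [Complex.sub_re, Complex.ofReal_re, Complex.one_re]
  have h3 := Real.rpow_le_rpow (abs_nonneg _) (abs_one_sub_rpow_le h1 h2 hr.1 hr.2) hp0.le
  rw [Real.mul_rpow hr1.le (Real.rpow_nonneg hr.1.le _), ← Real.rpow_mul hr.1.le] at h3
  unfold hardyIntegrand
  rw [div_le_iff₀ (Real.rpow_pos_of_pos hr1 _), mul_assoc, ← Real.rpow_add hr1]
  refine h3.trans (le_of_eq ?_)
  rw [mul_comm, hu]
  congr 2 <;> ring

lemma integral_hardyIntegrand_pos {p s : ℝ} (hp : 2 ≤ p) (hs0 : 0 < s) (hs1 : s < 1)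
    (hps : p * s ≠ 1) : 0 < ∫ r in (0 : ℝ)..1, hardyIntegrand p s r :=
  intervalIntegral.intervalIntegral_pos_of_pos_on (intervalIntegrable_hardyIntegrand hp hs0 hs1)
    (fun _ hr => hardyIntegrand_pos hp hps hr.1 hr.2) one_pos

lemma ofReal_integral_hardyIntegrand {p s : ℝ} (hp : 2 ≤ p) (hs0 : 0 < s) (hs1 : s < 1) :
    ENNReal.ofReal (∫ r in (0 : ℝ)..1, hardyIntegrand p s r)
      = ∫⁻ r in Set.Ioo 0 1, ENNReal.ofReal (hardyIntegrand p s r) := by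
  have h := intervalIntegrable_hardyIntegrand hp hs0 hs1
  rw [intervalIntegrable_iff_integrableOn_Ioo_of_le zero_le_one] at h
  rw [intervalIntegral.integral_of_le zero_le_one, integral_Ioc_eq_integral_Ioo,
    ofReal_integral_eq_lintegral_ofReal h]
  exact (ae_restrict_iff' measurableSet_Ioo).2
    (Eventually.of_forall fun r hr => hardyIntegrand_nonneg hr.2.le)

/-- The integral over `r = y_N / x_N < θ` obtained from the kernel and the ground state
`x_N ^ ((ps-1)/p)` when the variable `y` is integrated out. -/
noncomputable def lowerMass (p s θ : ℝ) : ℝ≥0∞ :=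
  ∫⁻ r in Set.Ioo 0 θ,
    ENNReal.ofReal (|1 - r ^ ((p * s - 1) / p)| ^ (p - 1) / (1 - r) ^ (1 + p * s))

/-- The integral over `r = y_N / x_N < θ` obtained from the kernel and the ground state
`x_N ^ ((ps-1)/p)` when the variable `x` is integrated out. -/
noncomputable def upperMass (p s θ : ℝ) : ℝ≥0∞ :=
  ∫⁻ r in Set.Ioo 0 θ,
    ENNReal.ofReal (|1 - r ^ ((p * s - 1) / p)| ^ (p - 1) * r ^ ((p * s - 1) / p)
      / (1 - r) ^ (1 + p * s))

lemma lowerMass_eq {p s θ : ℝ} (hp : 2 ≤ p) (hps : 1 < p * s) (hθ : θ ≤ 1) :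
    lowerMass p s θ = (∫⁻ r in Set.Ioo 0 θ, ENNReal.ofReal (hardyIntegrand p s r))
      + upperMass p s θ := by
  have hβ : 0 < (p * s - 1) / p := div_pos (by linarith) (by linarith)
  unfold lowerMass upperMass
  rw [← lintegral_add_left (measurable_hardyIntegrand p s).ennreal_ofReal]
  refine setLIntegral_congr_fun measurableSet_Ioo fun r hr => ?_
  have hr1 : r < 1 := hr.2.trans_le hθ
  have h1 : r ^ ((p * s - 1) / p) < 1 := Real.rpow_lt_one hr.1.le hr1 hβ
  have h2 : 0 < 1 - r ^ ((p * s - 1) / p) := by linarith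
  have h3 : 0 < 1 - r := by linarith
  have h4 : 0 < r ^ ((p * s - 1) / p) := Real.rpow_pos_of_pos hr.1 _
  rw [← ENNReal.ofReal_add (hardyIntegrand_nonneg hr1.le) (by positivity)]
  congr 1
  unfold hardyIntegrand
  rw [abs_of_pos h2, Real.rpow_sub_one h2.ne']
  field_simp
  ring

lemma upperMass_eq {p s θ : ℝ} (hp : 2 ≤ p) (hps : p * s < 1) (hθ : θ ≤ 1) :
    upperMass p s θ = (∫⁻ r in Set.Ioo 0 θ, ENNReal.ofReal (hardyIntegrand p s r))
      + lowerMass p s θ := by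
  have hβ : (p * s - 1) / p < 0 := div_neg_of_neg_of_pos (by linarith) (by linarith)
  unfold lowerMass upperMass
  rw [← lintegral_add_left (measurable_hardyIntegrand p s).ennreal_ofReal]
  refine setLIntegral_congr_fun measurableSet_Ioo fun r hr => ?_
  have hr1 : r < 1 := hr.2.trans_le hθ
  have h1 : 1 < r ^ ((p * s - 1) / p) := Real.one_lt_rpow_of_pos_of_lt_one_of_neg hr.1 hr1 hβ
  have h2 : 0 < -(1 - r ^ ((p * s - 1) / p)) := by linarith
  have h3 : 0 < 1 - r := by linarith
  rw [← ENNReal.ofReal_add (hardyIntegrand_nonneg hr1.le) (by positivity)]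
  congr 1
  unfold hardyIntegrand
  have h5 : 1 - r ^ ((p * s - 1) / p) ≠ 0 := by linarith
  rw [abs_of_neg (by linarith), Real.rpow_sub_one h2.ne']
  generalize r ^ ((p * s - 1) / p) = T at h5
  field_simp
  ring

lemma upperMass_lt_top {p s θ : ℝ} (hp : 2 ≤ p) (hps : 1 < p * s) (hθ : θ < 1) :
    upperMass p s θ < ⊤ := by
  have hβ : 0 < (p * s - 1) / p := div_pos (by linarith) (by linarith)
  have hθ' : 0 < 1 - θ := by linarith
  refine setLIntegral_lt_top_of_le_nnreal measure_Ioo_lt_top.ne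
    ⟨Real.toNNReal (1 / (1 - θ) ^ (1 + p * s)), fun r hr => ?_⟩
  refine ENNReal.ofReal_le_ofReal ?_
  have hr1 : r < 1 := hr.2.trans hθ
  have h1 : r ^ ((p * s - 1) / p) < 1 := Real.rpow_lt_one hr.1.le hr1 hβ
  have h4 : 0 < r ^ ((p * s - 1) / p) := Real.rpow_pos_of_pos hr.1 _
  have h2 : |1 - r ^ ((p * s - 1) / p)| ^ (p - 1) ≤ 1 :=
    Real.rpow_le_one (abs_nonneg _) (by rw [abs_le]; constructor <;> linarith) (by linarith)
  refine div_le_div₀ zero_le_one (mul_le_one₀ h2 h4.le h1.le) (Real.rpow_pos_of_pos hθ' _)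
    (Real.rpow_le_rpow hθ'.le (by linarith [hr.2]) (by linarith))

lemma lowerMass_lt_top {p s θ : ℝ} (hp : 2 ≤ p) (hs0 : 0 < s) (hps : p * s < 1) (hθ : θ < 1) :
    lowerMass p s θ < ⊤ := by
  have hp0 : 0 < p := by linarith
  have hps0 : 0 < p * s := by positivity
  have hβ : (p * s - 1) / p < 0 := div_neg_of_neg_of_pos (by linarith) hp0
  have hθ' : 0 < 1 - θ := by linarith
  have hint : IntervalIntegrable (fun r : ℝ => r ^ ((p * s - 1) / p * (p - 1))
      * (1 / (1 - θ) ^ (1 + p * s))) volume 0 1 := by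
    refine (intervalIntegral.intervalIntegrable_rpow' ?_).mul_const _
    rw [div_mul_eq_mul_div, lt_div_iff₀ hp0]
    nlinarith
  rw [intervalIntegrable_iff_integrableOn_Ioo_of_le zero_le_one] at hint
  refine lt_of_le_of_lt ?_ hint.hasFiniteIntegral
  refine (setLIntegral_mono' measurableSet_Ioo fun r hr => ?_).trans
    (lintegral_mono_set (Set.Ioo_subset_Ioo_right hθ.le))
  have hr1 : r < 1 := hr.2.trans hθ
  have h1 : 1 < r ^ ((p * s - 1) / p) := Real.one_lt_rpow_of_pos_of_lt_one_of_neg hr.1 hr1 hβ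
  rw [← ofReal_norm]
  refine ENNReal.ofReal_le_ofReal ((?_ : _ ≤ _).trans (le_abs_self _))
  beta_reduce
  rw [Real.rpow_mul hr.1.le, div_eq_mul_one_div]
  refine mul_le_mul (Real.rpow_le_rpow (abs_nonneg _) ?_ (by linarith))
    (one_div_le_one_div_of_le (Real.rpow_pos_of_pos hθ' _)
      (Real.rpow_le_rpow hθ'.le (by linarith [hr.2]) (by linarith)))
    (by have : 0 < 1 - r := by linarith
        positivity) (by positivity)
  rw [abs_of_neg (by linarith)]
  linarith

lemma lintegral_lower {p s θ a : ℝ} (ha : 0 < a) (hθ : θ < 1) :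
    ∫⁻ t in Set.Ioo 0 (θ * a), ENNReal.ofReal
      (|a ^ ((p * s - 1) / p) - t ^ ((p * s - 1) / p)| ^ (p - 1)) *
        ENNReal.ofReal (1 / |a - t| ^ (1 + p * s))
      = ENNReal.ofReal (a ^ ((p * s - 1) / p * (p - 1) - p * s)) * lowerMass p s θ := by
  obtain ⟨β, hβ⟩ : ∃ β, β = (p * s - 1) / p := ⟨_, rfl⟩
  have himg : (fun r => a * r) '' Set.Ioo 0 θ = Set.Ioo 0 (θ * a) := by
    rw [Set.image_mul_left_Ioo ha, mul_zero, mul_comm]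
  rw [← himg, lintegral_image_eq_lintegral_abs_deriv_mul (f := fun r => a * r) (f' := fun _ => a)
    measurableSet_Ioo
    (fun r _ => by simpa using ((hasDerivAt_id r).const_mul a).hasDerivWithinAt)
    (fun r _ r' _ h => by simpa [ha.ne'] using h)]
  unfold lowerMass
  rw [← hβ, ← lintegral_const_mul' _ _ ENNReal.ofReal_ne_top]
  refine setLIntegral_congr_fun measurableSet_Ioo fun r hr => ?_
  have h1 : 0 < 1 - r := by linarith [hr.2]
  rw [← ENNReal.ofReal_mul (by positivity), ← ENNReal.ofReal_mul (by positivity),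
    ← ENNReal.ofReal_mul (by positivity)]
  congr 1
  have e1 : a ^ β - (a * r) ^ β = a ^ β * (1 - r ^ β) := by
    rw [Real.mul_rpow ha.le hr.1.le]; ring
  have e2 : |a - a * r| = a * (1 - r) := by
    rw [show a - a * r = a * (1 - r) by ring]; exact abs_of_pos (by positivity)
  rw [e1, e2, abs_mul, abs_of_pos (Real.rpow_pos_of_pos ha β), abs_of_pos ha,
    Real.mul_rpow (by positivity) (abs_nonneg _), Real.mul_rpow ha.le h1.le, ← Real.rpow_mul ha.le,
    Real.rpow_sub ha, Real.rpow_add ha, Real.rpow_one]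
  field_simp

lemma lintegral_upper {p s θ b : ℝ} (hp : 2 ≤ p) (hb : 0 < b) (hθ0 : 0 < θ) (hθ : θ < 1) :
    ∫⁻ t in Set.Ioi (b / θ), ENNReal.ofReal
      (|t ^ ((p * s - 1) / p) - b ^ ((p * s - 1) / p)| ^ (p - 1)) *
        ENNReal.ofReal (1 / |b - t| ^ (1 + p * s))
      = ENNReal.ofReal (b ^ ((p * s - 1) / p * (p - 1) - p * s)) * upperMass p s θ := by
  obtain ⟨β, hβ⟩ : ∃ β, β = (p * s - 1) / p := ⟨_, rfl⟩
  have hβp : β * (p - 1) = p * s - 1 - β := by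
    rw [hβ]; have : p ≠ 0 := by linarith
    field_simp
  have himg : (fun r => b * r⁻¹) '' Set.Ioo 0 θ = Set.Ioi (b / θ) := by
    ext t
    constructor
    · rintro ⟨r, hr, rfl⟩
      simp only [Set.mem_Ioi, ← div_eq_mul_inv]
      exact div_lt_div_of_pos_left hb hr.1 hr.2
    · intro ht
      have ht0 : 0 < t := (div_pos hb hθ0).trans ht
      refine ⟨b / t, ⟨by positivity, ?_⟩, by simp only; field_simp⟩
      rw [div_lt_comm₀ ht0 hθ0]
      exact ht
  rw [← himg, lintegral_image_eq_lintegral_abs_deriv_mul (f := fun r => b * r⁻¹)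
    (f' := fun r => b * -(r ^ 2)⁻¹) measurableSet_Ioo
    (fun r hr => ((hasDerivAt_inv hr.1.ne').const_mul b).hasDerivWithinAt)
    (fun r _ r' _ h => by simpa [hb.ne'] using h)]
  unfold upperMass
  rw [← hβ, ← lintegral_const_mul' _ _ ENNReal.ofReal_ne_top]
  refine setLIntegral_congr_fun measurableSet_Ioo fun r hr => ?_
  have hr0 := hr.1
  have h1 : 0 < 1 - r := by linarith [hr.2]
  have hrβ : 0 < r ^ β := Real.rpow_pos_of_pos hr0 β
  rw [← ENNReal.ofReal_mul (by positivity), ← ENNReal.ofReal_mul (by positivity),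
    ← ENNReal.ofReal_mul (by positivity)]
  congr 1
  have e1 : |(b * r⁻¹) ^ β - b ^ β| = b ^ β * |1 - r ^ β| / r ^ β := by
    rw [Real.mul_rpow hb.le (by positivity), Real.inv_rpow hr0.le,
      show b ^ β * (r ^ β)⁻¹ - b ^ β = b ^ β * (1 - r ^ β) / r ^ β by field_simp, abs_div, abs_mul,
      abs_of_pos (Real.rpow_pos_of_pos hb β), abs_of_pos hrβ]
  have e2 : |b - b * r⁻¹| = b * (1 - r) / r := by
    rw [abs_sub_comm, show b * r⁻¹ - b = b * (1 - r) / r by field_simp]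
    exact abs_of_pos (by positivity)
  have e3 : |b * -(r ^ 2)⁻¹| = b / r ^ 2 := by
    rw [mul_neg, abs_neg, abs_of_pos (by positivity), div_eq_mul_inv]
  have e4 : (r ^ β) ^ (p - 1) = r ^ (p * s) / r / r ^ β := by
    rw [← Real.rpow_mul hr0.le, hβp, Real.rpow_sub hr0, Real.rpow_sub_one hr0.ne']
  rw [e1, e2, e3, Real.div_rpow (by positivity) hrβ.le, e4,
    Real.mul_rpow (by positivity) (abs_nonneg _), Real.div_rpow (by positivity) hr0.le,
    Real.mul_rpow hb.le h1.le, ← Real.rpow_mul hb.le,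
    Real.rpow_sub hb, Real.rpow_add hb, Real.rpow_add hr0, Real.rpow_one, Real.rpow_one]
  field_simp

/-! ### Integrating out the tangential variables -/

/-- The constant by which integrating out `x' ∈ ℝ^n` reduces `|x|^(-(n+1+σ))` to
`|x_N|^(-(1+σ))`. -/
noncomputable def kernelConst (n : ℕ) (σ : ℝ) : ℝ :=
  Real.pi ^ ((n : ℝ) / 2) * (Real.Gamma ((1 + σ) / 2) / Real.Gamma (((n + 1 : ℕ) + σ) / 2))

lemma kernelConst_pos (n : ℕ) {σ : ℝ} (hσ : 0 < σ) : 0 < kernelConst n σ := by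
  have h1 : 0 < Real.Gamma ((1 + σ) / 2) := Real.Gamma_pos_of_pos (by linarith)
  have h2 : 0 < Real.Gamma (((n + 1 : ℕ) + σ) / 2) := Real.Gamma_pos_of_pos (by positivity)
  have := Real.pi_pos
  unfold kernelConst
  positivity

lemma lintegral_rpow_mul_exp {q A : ℝ} (hq : 0 < q) (hA : 0 < A) :
    ∫⁻ t in Set.Ioi (0 : ℝ), ENNReal.ofReal (t ^ (q - 1) * Real.exp (-(A * t)))
      = ENNReal.ofReal ((1 / A) ^ q * Real.Gamma q) := by
  have h := Real.integral_rpow_mul_exp_neg_mul_Ioi hq hA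
  have hpos : 0 < (1 / A) ^ q * Real.Gamma q :=
    mul_pos (Real.rpow_pos_of_pos (by positivity) _) (Real.Gamma_pos_of_pos hq)
  rw [← h, ofReal_integral_eq_lintegral_ofReal]
  · by_contra hn
    rw [integral_undef hn] at h
    exact hpos.ne h
  · refine (ae_restrict_iff' measurableSet_Ioi).2 (Eventually.of_forall fun t ht => ?_)
    exact mul_nonneg (Real.rpow_nonneg (le_of_lt ht) _) (Real.exp_nonneg _)

lemma lintegral_exp_neg_mul_sq_norm (n : ℕ) {t : ℝ} (ht : 0 < t) :
    ∫⁻ z : EuclideanSpace ℝ (Fin n), ENNReal.ofReal (Real.exp (-t * ‖z‖ ^ 2))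
      = ENNReal.ofReal ((Real.pi / t) ^ ((n : ℝ) / 2)) := by
  have h := GaussianFourier.integral_rexp_neg_mul_sq_norm (V := EuclideanSpace ℝ (Fin n)) ht
  rw [finrank_euclideanSpace_fin] at h
  have hpos : 0 < (Real.pi / t) ^ ((n : ℝ) / 2) :=
    Real.rpow_pos_of_pos (div_pos Real.pi_pos ht) _
  rw [← h, ofReal_integral_eq_lintegral_ofReal]
  · by_contra hn
    rw [integral_undef hn] at h
    exact hpos.ne h
  · exact Eventually.of_forall fun t => Real.exp_nonneg _

/-- Computed by writing the power as a Gamma integral of Gaussians. -/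
lemma lintegral_norm_sq_add_sq_rpow (n : ℕ) {σ a : ℝ} (hσ : 0 < σ) (ha : 0 < a) :
    ∫⁻ z : EuclideanSpace ℝ (Fin n),
        ENNReal.ofReal (1 / (a ^ 2 + ‖z‖ ^ 2) ^ (((n + 1 : ℕ) + σ) / 2))
      = ENNReal.ofReal (kernelConst n σ) * ENNReal.ofReal (1 / a ^ (1 + σ)) := by
  obtain ⟨q, hq⟩ : ∃ q : ℝ, q = ((n + 1 : ℕ) + σ) / 2 := ⟨_, rfl⟩
  have hq0 : 0 < q := by rw [hq]; positivity
  have hqn : q - n / 2 = (1 + σ) / 2 := by rw [hq]; push_cast; ring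
  have hΓ : 0 < Real.Gamma q := Real.Gamma_pos_of_pos hq0
  have e1 : ∀ z : EuclideanSpace ℝ (Fin n),
      ENNReal.ofReal (Real.Gamma q) * ENNReal.ofReal (1 / (a ^ 2 + ‖z‖ ^ 2) ^ q)
        = ∫⁻ t in Set.Ioi (0 : ℝ),
          ENNReal.ofReal (t ^ (q - 1) * Real.exp (-((a ^ 2 + ‖z‖ ^ 2) * t))) := by
    intro z
    have hA : 0 < a ^ 2 + ‖z‖ ^ 2 := by positivity
    rw [lintegral_rpow_mul_exp hq0 hA, ← ENNReal.ofReal_mul hΓ.le, Real.div_rpow zero_le_one hA.le,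
      Real.one_rpow, mul_comm]
  have e2 : ∀ t ∈ Set.Ioi (0 : ℝ), ∫⁻ z : EuclideanSpace ℝ (Fin n),
      ENNReal.ofReal (t ^ (q - 1) * Real.exp (-((a ^ 2 + ‖z‖ ^ 2) * t)))
        = ENNReal.ofReal (Real.pi ^ ((n : ℝ) / 2)) *
          ENNReal.ofReal (t ^ ((1 + σ) / 2 - 1) * Real.exp (-(a ^ 2 * t))) := by
    intro t ht
    have ht : 0 < t := ht
    have e3 : ∀ z : EuclideanSpace ℝ (Fin n),
        ENNReal.ofReal (t ^ (q - 1) * Real.exp (-((a ^ 2 + ‖z‖ ^ 2) * t)))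
          = ENNReal.ofReal (t ^ (q - 1) * Real.exp (-(a ^ 2 * t))) *
            ENNReal.ofReal (Real.exp (-t * ‖z‖ ^ 2)) := by
      intro z
      rw [← ENNReal.ofReal_mul (by positivity), mul_assoc, ← Real.exp_add]
      congr 3
      ring
    simp_rw [e3]
    rw [lintegral_const_mul' _ _ ENNReal.ofReal_ne_top, lintegral_exp_neg_mul_sq_norm n ht,
      ← ENNReal.ofReal_mul (by positivity), ← ENNReal.ofReal_mul (by have := Real.pi_pos; positivity)]
    congr 1
    rw [← hqn, Real.div_rpow Real.pi_pos.le ht.le,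
      show q - n / 2 - 1 = q - 1 - n / 2 by ring, Real.rpow_sub ht (q - 1)]
    field_simp
  have hmeas : Measurable (Function.uncurry fun (z : EuclideanSpace ℝ (Fin n)) (t : ℝ) =>
      ENNReal.ofReal (t ^ (q - 1) * Real.exp (-((a ^ 2 + ‖z‖ ^ 2) * t)))) := by
    unfold Function.uncurry
    fun_prop
  have key : ENNReal.ofReal (Real.Gamma q) * ∫⁻ z : EuclideanSpace ℝ (Fin n),
        ENNReal.ofReal (1 / (a ^ 2 + ‖z‖ ^ 2) ^ q)
      = ENNReal.ofReal (Real.pi ^ ((n : ℝ) / 2)) *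
        ENNReal.ofReal ((1 / a ^ 2) ^ ((1 + σ) / 2) * Real.Gamma ((1 + σ) / 2)) := by
    rw [← lintegral_const_mul' _ _ ENNReal.ofReal_ne_top]
    simp_rw [e1]
    rw [lintegral_lintegral_swap hmeas.aemeasurable, setLIntegral_congr_fun measurableSet_Ioi e2,
      lintegral_const_mul' _ _ ENNReal.ofReal_ne_top,
      lintegral_rpow_mul_exp (by linarith) (by positivity)]
  rw [← hq]
  have hΓ' : ENNReal.ofReal (Real.Gamma q) ≠ 0 := (ENNReal.ofReal_pos.2 hΓ).ne'
  refine (ENNReal.mul_right_inj hΓ' ENNReal.ofReal_ne_top).1 (key.trans ?_)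
  have := Real.pi_pos
  have hk := (kernelConst_pos n hσ).le
  rw [← ENNReal.ofReal_mul (by positivity), ← ENNReal.ofReal_mul hk, ← ENNReal.ofReal_mul hΓ.le]
  congr 1
  unfold kernelConst
  rw [← hq, Real.div_rpow zero_le_one (by positivity), Real.one_rpow,
    ← Real.rpow_natCast_mul ha.le, show ((2 : ℕ) : ℝ) * ((1 + σ) / 2) = 1 + σ by push_cast; ring]
  field_simp

/-- Splitting off the last coordinate. -/
def splitLast (n : ℕ) (x : EuclideanSpace ℝ (Fin (n + 1))) : ℝ × EuclideanSpace ℝ (Fin n) :=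
  (x (Fin.last n), WithLp.toLp 2 fun i => x i.castSucc)

lemma measurePreserving_splitLast (n : ℕ) : MeasurePreserving (splitLast n) volume volume := by
  have h1 := EuclideanSpace.volume_preserving_symm_measurableEquiv_toLp (Fin (n + 1))
  have h2 := volume_preserving_piFinSuccAbove (fun _ : Fin (n + 1) => ℝ) (Fin.last n)
  have h3 := (MeasurePreserving.id (volume : Measure ℝ)).prod (PiLp.volume_preserving_toLp (Fin n))
  have e : splitLast n = Prod.map id (WithLp.toLp 2) ∘
      (MeasurableEquiv.piFinSuccAbove (fun _ : Fin (n + 1) => ℝ) (Fin.last n)) ∘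
      (MeasurableEquiv.toLp 2 (Fin (n + 1) → ℝ)).symm := by
    funext x
    refine Prod.ext rfl ?_
    ext i
    simp [splitLast, MeasurableEquiv.piFinSuccAbove, Fin.init]
  rw [e]
  exact h3.comp (h2.comp h1)

lemma norm_sub_sq_eq_splitLast {n : ℕ} (x y : EuclideanSpace ℝ (Fin (n + 1))) :
    ‖x - y‖ ^ 2 = ((splitLast n x).1 - (splitLast n y).1) ^ 2
      + ‖(splitLast n x).2 - (splitLast n y).2‖ ^ 2 := by
  simp [EuclideanSpace.norm_sq_eq, Fin.sum_univ_castSucc, splitLast, add_comm]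

lemma measurableSet_halfSpace (n : ℕ) : MeasurableSet (halfSpace n) := by
  unfold halfSpace
  exact measurableSet_lt measurable_const (by fun_prop)

lemma volume_setOf_last_eq (n : ℕ) (a : ℝ) :
    volume {y : EuclideanSpace ℝ (Fin (n + 1)) | y (Fin.last n) = a} = 0 := by
  have h := (measurePreserving_splitLast n).measure_preimage
    (s := {a} ×ˢ Set.univ) (by measurability)
  rw [Measure.volume_eq_prod, Measure.prod_prod, Real.volume_singleton, zero_mul] at h
  rw [← h]
  congr 1
  ext y
  simp [splitLast]

/-- Integration of a function of `y_N` against the kernel reduces to one dimension. -/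
lemma lintegral_halfSpace_kernel (n : ℕ) {σ : ℝ} (hσ : 0 < σ) {f : ℝ → ℝ≥0∞} (hf : Measurable f)
    (x : EuclideanSpace ℝ (Fin (n + 1))) :
    ∫⁻ y in halfSpace n, f (y (Fin.last n)) *
        ENNReal.ofReal (1 / ‖x - y‖ ^ (((n + 1 : ℕ) : ℝ) + σ))
      = ENNReal.ofReal (kernelConst n σ) *
        ∫⁻ t in Set.Ioi 0, f t * ENNReal.ofReal (1 / |x (Fin.last n) - t| ^ (1 + σ)) := by
  have e1 : ∀ y : EuclideanSpace ℝ (Fin (n + 1)), ‖x - y‖ ^ (((n + 1 : ℕ) : ℝ) + σ)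
      = ((x (Fin.last n) - (splitLast n y).1) ^ 2 + ‖(splitLast n x).2 - (splitLast n y).2‖ ^ 2) ^
        ((((n + 1 : ℕ) : ℝ) + σ) / 2) := by
    intro y
    have := norm_sub_sq_eq_splitLast x y
    simp only [show (splitLast n x).1 = x (Fin.last n) from rfl] at this
    rw [← this, ← Real.rpow_natCast_mul (norm_nonneg _)]
    congr 1
    push_cast
    ring
  have e2 : halfSpace n = splitLast n ⁻¹' (Set.Ioi 0 ×ˢ Set.univ) := by
    ext y
    simp [halfSpace, splitLast]
  simp_rw [e1]
  have hm : Measurable fun z : ℝ × EuclideanSpace ℝ (Fin n) => f z.1 *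
      ENNReal.ofReal (1 / ((x (Fin.last n) - z.1) ^ 2 + ‖(splitLast n x).2 - z.2‖ ^ 2) ^
        ((((n + 1 : ℕ) : ℝ) + σ) / 2)) := by
    fun_prop
  have e3 := (measurePreserving_splitLast n).setLIntegral_comp_preimage
    (s := Set.Ioi 0 ×ˢ Set.univ) (by measurability) hm
  rw [e2]
  refine e3.trans ?_
  rw [Measure.volume_eq_prod, ← Measure.prod_restrict, lintegral_prod _ hm.aemeasurable,
    Measure.restrict_univ, ← lintegral_const_mul' _ _ ENNReal.ofReal_ne_top]
  have h0 : ∀ᵐ t : ℝ ∂(volume.restrict (Set.Ioi 0)), t ≠ x (Fin.last n) :=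
    ae_restrict_of_ae (Measure.ae_ne volume _)
  refine lintegral_congr_ae ?_
  filter_upwards [h0] with t ht
  have ha : 0 < |x (Fin.last n) - t| := abs_pos.2 (sub_ne_zero.2 ht.symm)
  have h1 := lintegral_norm_sq_add_sq_rpow n hσ ha
  have h2 : Measurable fun z : EuclideanSpace ℝ (Fin n) =>
      ENNReal.ofReal (1 / ((x (Fin.last n) - t) ^ 2 + ‖(splitLast n x).2 - z‖ ^ 2) ^
        ((((n + 1 : ℕ) : ℝ) + σ) / 2)) := by
    fun_prop
  rw [lintegral_const_mul _ h2, lintegral_sub_left_eq_self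
    (fun z : EuclideanSpace ℝ (Fin n) => ENNReal.ofReal
      (1 / ((x (Fin.last n) - t) ^ 2 + ‖z‖ ^ 2) ^ ((((n + 1 : ℕ) : ℝ) + σ) / 2)))
    ((splitLast n x).2)]
  rw [sq_abs] at h1
  rw [h1]
  ring

/-! ### The ground state representation -/

section GroundState

variable {𝕜 : Type*} [RCLike 𝕜] {n : ℕ}

/-- The cone of pairs of points of the half-space with `y_N < θ x_N`. For `θ < 1` it keeps away from
the diagonal and is invariant under dilations. -/
def heightCone (n : ℕ) (θ : ℝ) :
    Set (EuclideanSpace ℝ (Fin (n + 1)) × EuclideanSpace ℝ (Fin (n + 1))) :=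
  {z | 0 < z.2 (Fin.last n) ∧ z.2 (Fin.last n) < θ * z.1 (Fin.last n)}

/-- The integrand of the Gagliardo energy. -/
noncomputable def gagliardoDensity (p s : ℝ) (u : EuclideanSpace ℝ (Fin (n + 1)) → 𝕜)
    (z : EuclideanSpace ℝ (Fin (n + 1)) × EuclideanSpace ℝ (Fin (n + 1))) : ℝ≥0∞ :=
  ENNReal.ofReal (‖u z.1 - u z.2‖ ^ p / ‖z.1 - z.2‖ ^ (((n + 1 : ℕ) : ℝ) + p * s))

/-- The integrand of the weighted energy. -/
noncomputable def weightedDensity (p s : ℝ) (v : EuclideanSpace ℝ (Fin (n + 1)) → 𝕜)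
    (z : EuclideanSpace ℝ (Fin (n + 1)) × EuclideanSpace ℝ (Fin (n + 1))) : ℝ≥0∞ :=
  ENNReal.ofReal (‖v z.1 - v z.2‖ ^ p / ‖z.1 - z.2‖ ^ (((n + 1 : ℕ) : ℝ) + p * s)
      / z.1 (Fin.last n) ^ ((1 - p * s) / 2) / z.2 (Fin.last n) ^ ((1 - p * s) / 2))

/-- The kernel times `|ω(z.1) - ω(z.2)|^(p-1)` times the value of `|u|^p ω^(1-p)` at `w`, which will
be one of the points `z.1`, `z.2`. The difference of the two choices is the first variation of the
energy at the ground state `ω`, tested with `|u|^p ω^(1-p)`. -/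
noncomputable def crossDensity (p s : ℝ) (u : EuclideanSpace ℝ (Fin (n + 1)) → 𝕜)
    (w : EuclideanSpace ℝ (Fin (n + 1)))
    (z : EuclideanSpace ℝ (Fin (n + 1)) × EuclideanSpace ℝ (Fin (n + 1))) : ℝ≥0∞ :=
  ENNReal.ofReal (‖u w‖ ^ p * w (Fin.last n) ^ (-((p * s - 1) / p * (p - 1)))) *
    (ENNReal.ofReal (|z.1 (Fin.last n) ^ ((p * s - 1) / p)
        - z.2 (Fin.last n) ^ ((p * s - 1) / p)| ^ (p - 1)) *
      ENNReal.ofReal (1 / ‖z.1 - z.2‖ ^ (((n + 1 : ℕ) : ℝ) + p * s)))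

lemma measurableSet_heightCone (n : ℕ) (θ : ℝ) : MeasurableSet (heightCone n θ) := by
  have h1 : Measurable fun z : EuclideanSpace ℝ (Fin (n + 1)) × EuclideanSpace ℝ (Fin (n + 1)) =>
      z.1 (Fin.last n) := by fun_prop
  have h2 : Measurable fun z : EuclideanSpace ℝ (Fin (n + 1)) × EuclideanSpace ℝ (Fin (n + 1)) =>
      z.2 (Fin.last n) := by fun_prop
  exact (measurableSet_lt measurable_const h2).inter (measurableSet_lt h2 (h1.const_mul θ))

lemma measurable_gagliardoDensity (p s : ℝ) {u : EuclideanSpace ℝ (Fin (n + 1)) → 𝕜}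
    (hu : Measurable u) : Measurable (gagliardoDensity p s u) := by
  unfold gagliardoDensity
  fun_prop

lemma measurable_weightedDensity (p s : ℝ) {v : EuclideanSpace ℝ (Fin (n + 1)) → 𝕜}
    (hv : Measurable v) : Measurable (weightedDensity p s v) := by
  unfold weightedDensity
  fun_prop

lemma measurable_crossDensity_fst (p s : ℝ) {u : EuclideanSpace ℝ (Fin (n + 1)) → 𝕜}
    (hu : Measurable u) : Measurable fun z => crossDensity p s u z.1 z := by
  unfold crossDensity
  fun_prop

lemma measurable_crossDensity_snd (p s : ℝ) {u : EuclideanSpace ℝ (Fin (n + 1)) → 𝕜}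
    (hu : Measurable u) : Measurable fun z => crossDensity p s u z.2 z := by
  unfold crossDensity
  fun_prop

lemma measurable_hardyDensity (p s : ℝ) {u : EuclideanSpace ℝ (Fin (n + 1)) → 𝕜}
    (hu : Measurable u) :
    Measurable fun x => ENNReal.ofReal (‖u x‖ ^ p / x (Fin.last n) ^ (p * s)) := by
  fun_prop

lemma ofReal_mul_ground_state {p s a U : ℝ} (ha : 0 < a) (hU : 0 ≤ U) (K M : ℝ≥0∞) :
    ENNReal.ofReal (U * a ^ (-((p * s - 1) / p * (p - 1)))) *
      (K * (ENNReal.ofReal (a ^ ((p * s - 1) / p * (p - 1) - p * s)) * M))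
      = K * M * ENNReal.ofReal (U / a ^ (p * s)) := by
  have e : U / a ^ (p * s) = U * a ^ (-((p * s - 1) / p * (p - 1))) *
      a ^ ((p * s - 1) / p * (p - 1) - p * s) := by
    rw [mul_assoc, ← Real.rpow_add ha, div_eq_mul_inv, ← Real.rpow_neg ha.le]
    congr 2
    ring
  rw [e, ENNReal.ofReal_mul (p := U * _) (by positivity)]
  ring

lemma lintegral_crossDensity_fst {p s θ : ℝ} (hps : 0 < p * s) (hθ0 : 0 < θ) (hθ : θ < 1)
    {u : EuclideanSpace ℝ (Fin (n + 1)) → 𝕜} (hu : Measurable u) :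
    ∫⁻ z in heightCone n θ, crossDensity p s u z.1 z
      = ENNReal.ofReal (kernelConst n (p * s)) * lowerMass p s θ * hardyTerm p s u := by
  rw [← lintegral_indicator (measurableSet_heightCone n θ), Measure.volume_eq_prod,
    lintegral_prod _ ((measurable_crossDensity_fst p s hu).indicator
      (measurableSet_heightCone n θ)).aemeasurable]
  have key : ∀ x : EuclideanSpace ℝ (Fin (n + 1)),
      ∫⁻ y, (heightCone n θ).indicator (fun z => crossDensity p s u z.1 z) (x, y)
        = (halfSpace n).indicator (fun x => ENNReal.ofReal (kernelConst n (p * s)) *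
          lowerMass p s θ * ENNReal.ofReal (‖u x‖ ^ p / x (Fin.last n) ^ (p * s))) x := by
    intro x
    by_cases hx : x ∈ halfSpace n
    · have hx' : 0 < x (Fin.last n) := hx
      rw [Set.indicator_of_mem hx]
      obtain ⟨f, hf⟩ : ∃ f : ℝ → ℝ≥0∞, f = (Set.Iio (θ * x (Fin.last n))).indicator fun t =>
        ENNReal.ofReal (|x (Fin.last n) ^ ((p * s - 1) / p) - t ^ ((p * s - 1) / p)| ^ (p - 1)) :=
        ⟨_, rfl⟩
      have hfm : Measurable f := by
        rw [hf]
        exact Measurable.indicator (by fun_prop) measurableSet_Iio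
      have e1 : ∀ y, (heightCone n θ).indicator (fun z => crossDensity p s u z.1 z) (x, y)
          = (halfSpace n).indicator (fun y => ENNReal.ofReal (‖u x‖ ^ p *
            x (Fin.last n) ^ (-((p * s - 1) / p * (p - 1)))) * (f (y (Fin.last n)) *
              ENNReal.ofReal (1 / ‖x - y‖ ^ (((n + 1 : ℕ) : ℝ) + p * s)))) y := by
        intro y
        by_cases hy : y ∈ halfSpace n
        · rw [Set.indicator_of_mem hy, hf]
          by_cases hxy : y (Fin.last n) < θ * x (Fin.last n)
          · rw [Set.indicator_of_mem (show (x, y) ∈ heightCone n θ from ⟨hy, hxy⟩),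
              Set.indicator_of_mem (show y (Fin.last n) ∈ Set.Iio _ from hxy)]
            rfl
          · rw [Set.indicator_of_notMem (fun h => hxy h.2),
              Set.indicator_of_notMem (show y (Fin.last n) ∉ Set.Iio _ from hxy)]
            simp
        · rw [Set.indicator_of_notMem hy, Set.indicator_of_notMem (fun h => hy h.1)]
      simp_rw [e1]
      rw [lintegral_indicator (measurableSet_halfSpace n),
        lintegral_const_mul' _ _ ENNReal.ofReal_ne_top, lintegral_halfSpace_kernel n hps hfm]
      have e2 : ∫⁻ t in Set.Ioi 0, f t * ENNReal.ofReal (1 / |x (Fin.last n) - t| ^ (1 + p * s))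
          = ∫⁻ t in Set.Ioo 0 (θ * x (Fin.last n)), ENNReal.ofReal
            (|x (Fin.last n) ^ ((p * s - 1) / p) - t ^ ((p * s - 1) / p)| ^ (p - 1)) *
              ENNReal.ofReal (1 / |x (Fin.last n) - t| ^ (1 + p * s)) := by
        rw [← Set.Ioi_inter_Iio, Set.inter_comm, ← setLIntegral_indicator measurableSet_Iio]
        refine lintegral_congr fun t => ?_
        rw [hf, Set.indicator_mul_left]
      rw [e2, lintegral_lower hx' hθ, ofReal_mul_ground_state hx' (by positivity)]
    · rw [Set.indicator_of_notMem hx]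
      have e1 : ∀ y, (heightCone n θ).indicator (fun z => crossDensity p s u z.1 z) (x, y) = 0 :=
        fun y => Set.indicator_of_notMem
          (fun h => hx (pos_of_mul_pos_right (h.1.trans h.2) hθ0.le)) _
      simp_rw [e1]
      simp
  simp_rw [key]
  rw [lintegral_indicator (measurableSet_halfSpace n),
    lintegral_const_mul _ (measurable_hardyDensity p s hu)]
  rfl

lemma lintegral_crossDensity_snd {p s θ : ℝ} (hp : 2 ≤ p) (hps : 0 < p * s) (hθ0 : 0 < θ)
    (hθ : θ < 1) {u : EuclideanSpace ℝ (Fin (n + 1)) → 𝕜} (hu : Measurable u) :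
    ∫⁻ z in heightCone n θ, crossDensity p s u z.2 z
      = ENNReal.ofReal (kernelConst n (p * s)) * upperMass p s θ * hardyTerm p s u := by
  rw [← lintegral_indicator (measurableSet_heightCone n θ), Measure.volume_eq_prod,
    lintegral_prod_symm _ ((measurable_crossDensity_snd p s hu).indicator
      (measurableSet_heightCone n θ)).aemeasurable]
  have key : ∀ y : EuclideanSpace ℝ (Fin (n + 1)),
      ∫⁻ x, (heightCone n θ).indicator (fun z => crossDensity p s u z.2 z) (x, y)
        = (halfSpace n).indicator (fun y => ENNReal.ofReal (kernelConst n (p * s)) *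
          upperMass p s θ * ENNReal.ofReal (‖u y‖ ^ p / y (Fin.last n) ^ (p * s))) y := by
    intro y
    by_cases hy : y ∈ halfSpace n
    · have hy' : 0 < y (Fin.last n) := hy
      rw [Set.indicator_of_mem hy]
      obtain ⟨f, hf⟩ : ∃ f : ℝ → ℝ≥0∞, f = (Set.Ioi (y (Fin.last n) / θ)).indicator fun t =>
        ENNReal.ofReal (|t ^ ((p * s - 1) / p) - y (Fin.last n) ^ ((p * s - 1) / p)| ^ (p - 1)) :=
        ⟨_, rfl⟩
      have hfm : Measurable f := by
        rw [hf]
        exact Measurable.indicator (by fun_prop) measurableSet_Ioi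
      have e1 : ∀ x, (heightCone n θ).indicator (fun z => crossDensity p s u z.2 z) (x, y)
          = (halfSpace n).indicator (fun x => ENNReal.ofReal (‖u y‖ ^ p *
            y (Fin.last n) ^ (-((p * s - 1) / p * (p - 1)))) * (f (x (Fin.last n)) *
              ENNReal.ofReal (1 / ‖x - y‖ ^ (((n + 1 : ℕ) : ℝ) + p * s)))) x := by
        intro x
        by_cases hxy : y (Fin.last n) / θ < x (Fin.last n)
        · have hx : x ∈ halfSpace n := (div_pos hy' hθ0).trans hxy
          rw [Set.indicator_of_mem hx, hf, Set.indicator_of_mem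
            (show (x, y) ∈ heightCone n θ from ⟨hy, by rwa [div_lt_iff₀' hθ0] at hxy⟩),
            Set.indicator_of_mem (show x (Fin.last n) ∈ Set.Ioi _ from hxy)]
          rfl
        · rw [Set.indicator_of_notMem (fun h => hxy ((div_lt_iff₀' hθ0).2 h.2)), hf]
          by_cases hx : x ∈ halfSpace n
          · rw [Set.indicator_of_mem hx,
              Set.indicator_of_notMem (show x (Fin.last n) ∉ Set.Ioi _ from hxy)]
            simp
          · rw [Set.indicator_of_notMem hx]
      have hker := lintegral_halfSpace_kernel n hps hfm y
      simp_rw [norm_sub_rev y] at hker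
      simp_rw [e1]
      rw [lintegral_indicator (measurableSet_halfSpace n),
        lintegral_const_mul' _ _ ENNReal.ofReal_ne_top, hker]
      have e2 : ∫⁻ t in Set.Ioi 0, f t * ENNReal.ofReal (1 / |y (Fin.last n) - t| ^ (1 + p * s))
          = ∫⁻ t in Set.Ioi (y (Fin.last n) / θ), ENNReal.ofReal
            (|t ^ ((p * s - 1) / p) - y (Fin.last n) ^ ((p * s - 1) / p)| ^ (p - 1)) *
              ENNReal.ofReal (1 / |y (Fin.last n) - t| ^ (1 + p * s)) := by
        rw [← sup_of_le_left (div_pos hy' hθ0).le, ← Set.Ioi_inter_Ioi,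
          ← setLIntegral_indicator measurableSet_Ioi]
        refine lintegral_congr fun t => ?_
        rw [hf, Set.indicator_mul_left]
      rw [e2, lintegral_upper hp hy' hθ0 hθ, ofReal_mul_ground_state hy' (by positivity)]
    · rw [Set.indicator_of_notMem hy]
      have e1 : ∀ x, (heightCone n θ).indicator (fun z => crossDensity p s u z.2 z) (x, y) = 0 :=
        fun x => Set.indicator_of_notMem (fun h => hy h.1) _
      simp_rw [e1]
      simp
  simp_rw [key]
  rw [lintegral_indicator (measurableSet_halfSpace n),
    lintegral_const_mul _ (measurable_hardyDensity p s hu)]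
  rfl

/-- A symmetric double integral over the half-space is twice the integral over `y_N < x_N`. -/
lemma lintegral_halfSpace_eq_two_mul
    {f : EuclideanSpace ℝ (Fin (n + 1)) × EuclideanSpace ℝ (Fin (n + 1)) → ℝ≥0∞}
    (hf : Measurable f) (hsymm : ∀ z, f z.swap = f z) :
    ∫⁻ x in halfSpace n, ∫⁻ y in halfSpace n, f (x, y) = 2 * ∫⁻ z in heightCone n 1, f z := by
  rw [← lintegral_prod f hf.aemeasurable, Measure.prod_restrict]
  have hnull : (volume.prod volume) {z : EuclideanSpace ℝ (Fin (n + 1)) ×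
      EuclideanSpace ℝ (Fin (n + 1)) | z.2 (Fin.last n) = z.1 (Fin.last n)} = 0 := by
    rw [Measure.measure_prod_null (measurableSet_eq_fun (by fun_prop) (by fun_prop))]
    exact Eventually.of_forall fun x => volume_setOf_last_eq n (x (Fin.last n))
  have hae : (halfSpace n ×ˢ halfSpace n : Set _) =ᵐ[volume.prod volume]
      (heightCone n 1 ∪ Prod.swap ⁻¹' heightCone n 1 : Set _) := by
    refine eventuallyEq_set.2 ?_
    have h0 : ∀ᵐ z ∂(volume.prod volume : Measure (EuclideanSpace ℝ (Fin (n + 1)) ×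
      EuclideanSpace ℝ (Fin (n + 1)))), z.2 (Fin.last n) ≠ z.1 (Fin.last n) := by
      rw [ae_iff]
      simpa using hnull
    filter_upwards [h0] with z hz
    simp only [Set.mem_prod, halfSpace, heightCone, Set.mem_ofPred_eq, Set.mem_union,
      Set.mem_preimage, Prod.fst_swap, Prod.snd_swap, one_mul]
    constructor
    · rintro ⟨h1, h2⟩
      rcases hz.lt_or_gt with h | h
      · exact Or.inl ⟨h2, h⟩
      · exact Or.inr ⟨h1, h⟩
    · rintro (⟨h1, h2⟩ | ⟨h1, h2⟩)
      · exact ⟨h1.trans h2, h1⟩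
      · exact ⟨h1, h1.trans h2⟩
  have hdisj : Disjoint (heightCone n 1) (Prod.swap ⁻¹' heightCone n 1) := by
    rw [Set.disjoint_left]
    rintro z ⟨-, h1⟩ ⟨-, h2⟩
    simp only [Prod.fst_swap, Prod.snd_swap, one_mul] at h1 h2
    exact lt_asymm h1 h2
  have hswap := (Measure.measurePreserving_swap
    (μ := (volume : Measure (EuclideanSpace ℝ (Fin (n + 1)))))
    (ν := (volume : Measure (EuclideanSpace ℝ (Fin (n + 1)))))).setLIntegral_comp_preimage
      (measurableSet_heightCone n 1) hf
  simp_rw [hsymm] at hswap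
  rw [setLIntegral_congr hae,
    lintegral_union ((measurableSet_heightCone n 1).preimage measurable_swap) hdisj, hswap,
    two_mul]
  rfl

lemma tendsto_setLIntegral_iUnion {α : Type*} [MeasurableSpace α] (μ : Measure α)
    (f : α → ℝ≥0∞) {s : ℕ → Set α} (hs : Monotone s) :
    Tendsto (fun m => ∫⁻ x in s m, f x ∂μ) atTop (𝓝 (∫⁻ x in ⋃ m, s m, f x ∂μ)) := by
  rw [setLIntegral_iUnion_of_directed f hs.directed_le]
  exact tendsto_atTop_iSup fun i j h => lintegral_mono_set (hs h)

/-- A sequence in `(0, 1)` which increases to `1`. -/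
noncomputable def cutoff (m : ℕ) : ℝ := 1 - 1 / ((m : ℝ) + 2)

lemma cutoff_pos (m : ℕ) : 0 < cutoff m := by
  unfold cutoff
  rw [sub_pos, div_lt_one (by positivity)]
  linarith [(Nat.cast_nonneg m : (0 : ℝ) ≤ m)]

lemma cutoff_lt_one (m : ℕ) : cutoff m < 1 := by
  unfold cutoff
  have : 0 < 1 / ((m : ℝ) + 2) := by positivity
  linarith

lemma monotone_cutoff : Monotone cutoff := by
  intro i j h
  unfold cutoff
  have : (i : ℝ) ≤ j := by exact_mod_cast h
  gcongr

lemma exists_lt_cutoff {r : ℝ} (hr : r < 1) : ∃ m, r < cutoff m := by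
  obtain ⟨m, hm⟩ := exists_nat_one_div_lt (sub_pos.2 hr)
  refine ⟨m, ?_⟩
  have : 1 / ((m : ℝ) + 2) ≤ 1 / ((m : ℝ) + 1) :=
    one_div_le_one_div_of_le (by positivity) (by linarith)
  unfold cutoff
  linarith

lemma heightCone_pos {θ : ℝ} (hθ : 0 < θ)
    {z : EuclideanSpace ℝ (Fin (n + 1)) × EuclideanSpace ℝ (Fin (n + 1))}
    (hz : z ∈ heightCone n θ) : 0 < z.1 (Fin.last n) :=
  pos_of_mul_pos_right (hz.1.trans hz.2) hθ.le

lemma monotone_heightCone_cutoff (n : ℕ) : Monotone fun m => heightCone n (cutoff m) :=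
  fun i _ h _ hz => ⟨hz.1, hz.2.trans_le
    (mul_le_mul_of_nonneg_right (monotone_cutoff h) (heightCone_pos (cutoff_pos i) hz).le)⟩

lemma iUnion_heightCone_cutoff (n : ℕ) : ⋃ m, heightCone n (cutoff m) = heightCone n 1 := by
  ext z
  rw [Set.mem_iUnion]
  constructor
  · rintro ⟨m, hz⟩
    exact ⟨hz.1, hz.2.trans_le (mul_le_mul_of_nonneg_right (cutoff_lt_one m).le
      (heightCone_pos (cutoff_pos m) hz).le)⟩
  · intro hz
    have h0 := heightCone_pos one_pos hz
    have h1 := hz.2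
    rw [one_mul] at h1
    obtain ⟨m, hm⟩ := exists_lt_cutoff ((div_lt_one h0).2 h1)
    exact ⟨m, hz.1, (div_lt_iff₀ h0).1 hm⟩

lemma iUnion_Ioo_cutoff : ⋃ m, Set.Ioo 0 (cutoff m) = Set.Ioo (0 : ℝ) 1 := by
  ext r
  rw [Set.mem_iUnion]
  constructor
  · rintro ⟨m, hr⟩
    exact ⟨hr.1, hr.2.trans (cutoff_lt_one m)⟩
  · intro hr
    obtain ⟨m, hm⟩ := exists_lt_cutoff hr.2
    exact ⟨m, hr.1, hm⟩

lemma ground_state_rescale {E : Type*} [NormedAddCommGroup E] [NormedSpace ℝ E] {a p : ℝ}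
    (ha : 0 < a) (U : E) : a * ‖a⁻¹ • U‖ ^ p = ‖U‖ ^ p * a ^ (1 - p) := by
  rw [norm_smul, norm_inv, Real.norm_of_nonneg ha.le, Real.mul_rpow (by positivity) (norm_nonneg _),
    Real.inv_rpow ha.le, Real.rpow_sub ha, Real.rpow_one]
  field_simp

lemma norm_sub_rpow_ground_state {p c : ℝ} (hp : 2 ≤ p) (hc1 : c ≤ 1)
    (hc : ∀ τ ∈ Set.Ioo (0 : ℝ) (1 / 2), c ≤ remainderFun p τ) {a b : ℝ} (hb : 0 < b)
    (hba : b ≤ a) (U V : 𝕜) :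
    (‖U‖ ^ p * a ^ (1 - p)) * (a - b) ^ (p - 1)
        + c * ((a * b) ^ (p / 2) * ‖a⁻¹ • U - b⁻¹ • V‖ ^ p)
      ≤ ‖U - V‖ ^ p + (‖V‖ ^ p * b ^ (1 - p)) * (a - b) ^ (p - 1) := by
  have ha : 0 < a := hb.trans_le hba
  have h := norm_smul_sub_smul_rpow_ge hp hc1 hc hb hba (a⁻¹ • U) (b⁻¹ • V)
  rw [smul_inv_smul₀ ha.ne', smul_inv_smul₀ hb.ne', ground_state_rescale ha,
    ground_state_rescale hb] at h
  linarith

lemma norm_sub_sq_ground_state {a b : ℝ} (hb : 0 < b) (hba : b ≤ a) (U V : 𝕜) :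
    (‖U‖ ^ (2 : ℝ) * a ^ (1 - 2 : ℝ)) * (a - b) ^ (2 - 1 : ℝ)
        + 1 * ((a * b) ^ (2 / 2 : ℝ) * ‖a⁻¹ • U - b⁻¹ • V‖ ^ (2 : ℝ))
      = ‖U - V‖ ^ (2 : ℝ) + (‖V‖ ^ (2 : ℝ) * b ^ (1 - 2 : ℝ)) * (a - b) ^ (2 - 1 : ℝ) := by
  have ha : 0 < a := hb.trans_le hba
  have h := norm_smul_sub_smul_sq a b (a⁻¹ • U) (b⁻¹ • V)
  simp only [← Real.rpow_two] at h
  rw [smul_inv_smul₀ ha.ne', smul_inv_smul₀ hb.ne', ground_state_rescale ha,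
    ground_state_rescale hb] at h
  rw [h, div_self two_ne_zero, show (2 - 1 : ℝ) = 1 by norm_num, Real.rpow_one, Real.rpow_one]
  ring

lemma gagliardoDensity_swap (p s : ℝ) (u : EuclideanSpace ℝ (Fin (n + 1)) → 𝕜)
    (z : EuclideanSpace ℝ (Fin (n + 1)) × EuclideanSpace ℝ (Fin (n + 1))) :
    gagliardoDensity p s u z.swap = gagliardoDensity p s u z := by
  simp only [gagliardoDensity, Prod.fst_swap, Prod.snd_swap]
  rw [norm_sub_rev (u z.2), norm_sub_rev z.2]

lemma weightedDensity_swap (p s : ℝ) (v : EuclideanSpace ℝ (Fin (n + 1)) → 𝕜)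
    (z : EuclideanSpace ℝ (Fin (n + 1)) × EuclideanSpace ℝ (Fin (n + 1))) :
    weightedDensity p s v z.swap = weightedDensity p s v z := by
  simp only [weightedDensity, Prod.fst_swap, Prod.snd_swap]
  rw [norm_sub_rev (v z.2), norm_sub_rev z.2, div_right_comm]

lemma crossDensity_swap (p s : ℝ) (u : EuclideanSpace ℝ (Fin (n + 1)) → 𝕜)
    (w : EuclideanSpace ℝ (Fin (n + 1)))
    (z : EuclideanSpace ℝ (Fin (n + 1)) × EuclideanSpace ℝ (Fin (n + 1))) :
    crossDensity p s u w z.swap = crossDensity p s u w z := by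
  simp only [crossDensity, Prod.fst_swap, Prod.snd_swap]
  rw [abs_sub_comm, norm_sub_rev z.2]

lemma gagliardoEnergy_eq {p s : ℝ} {u : EuclideanSpace ℝ (Fin (n + 1)) → 𝕜} (hu : Measurable u) :
    gagliardoEnergy p s u = 2 * ∫⁻ z in heightCone n 1, gagliardoDensity p s u z := by
  rw [← lintegral_halfSpace_eq_two_mul (measurable_gagliardoDensity p s hu)
    (gagliardoDensity_swap p s u)]
  rfl

lemma weightedEnergy_eq {p s : ℝ} {v : EuclideanSpace ℝ (Fin (n + 1)) → 𝕜} (hv : Measurable v) :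
    weightedEnergy p s v = 2 * ∫⁻ z in heightCone n 1, weightedDensity p s v z := by
  rw [← lintegral_halfSpace_eq_two_mul (measurable_weightedDensity p s hv)
    (weightedDensity_swap p s v)]
  rfl

/-- The function `v = u / ω`, where `ω = x_N ^ ((ps-1)/p)` is the ground state. -/
noncomputable def groundQuotient (p s : ℝ) (u : EuclideanSpace ℝ (Fin (n + 1)) → 𝕜)
    (x : EuclideanSpace ℝ (Fin (n + 1))) : 𝕜 :=
  (x (Fin.last n) ^ ((1 - p * s) / p)) • u x

lemma measurable_groundQuotient (p s : ℝ) {u : EuclideanSpace ℝ (Fin (n + 1)) → 𝕜}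
    (hu : Measurable u) : Measurable (groundQuotient p s u) := by
  unfold groundQuotient
  fun_prop

lemma sum_density_eq {p s c : ℝ} (hp : 2 ≤ p) (hc : 0 ≤ c)
    (u : EuclideanSpace ℝ (Fin (n + 1)) → 𝕜)
    {z : EuclideanSpace ℝ (Fin (n + 1)) × EuclideanSpace ℝ (Fin (n + 1))}
    (h1 : 0 < z.1 (Fin.last n)) (h2 : 0 < z.2 (Fin.last n)) {a b : ℝ}
    (ha : a = z.1 (Fin.last n) ^ ((p * s - 1) / p)) (hb : b = z.2 (Fin.last n) ^ ((p * s - 1) / p))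
    (hba : b ≤ a) :
    crossDensity p s u z.1 z + ENNReal.ofReal c * weightedDensity p s (groundQuotient p s u) z
      = ENNReal.ofReal (((‖u z.1‖ ^ p * a ^ (1 - p)) * (a - b) ^ (p - 1)
        + c * ((a * b) ^ (p / 2) * ‖a⁻¹ • u z.1 - b⁻¹ • u z.2‖ ^ p)) *
          (1 / ‖z.1 - z.2‖ ^ (((n + 1 : ℕ) : ℝ) + p * s))) ∧
    gagliardoDensity p s u z + crossDensity p s u z.2 z
      = ENNReal.ofReal ((‖u z.1 - u z.2‖ ^ p + (‖u z.2‖ ^ p * b ^ (1 - p)) * (a - b) ^ (p - 1)) *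
          (1 / ‖z.1 - z.2‖ ^ (((n + 1 : ℕ) : ℝ) + p * s))) := by
  have hp0 : p ≠ 0 := by linarith
  have ha0 : 0 < a := ha ▸ Real.rpow_pos_of_pos h1 _
  have hb0 : 0 < b := hb ▸ Real.rpow_pos_of_pos h2 _
  have hab : 0 ≤ a - b := sub_nonneg.2 hba
  have hpow : ∀ t r : ℝ, 0 < t → r = t ^ ((p * s - 1) / p) →
      t ^ (-((p * s - 1) / p * (p - 1))) = r ^ (1 - p) := by
    rintro t _ ht rfl
    rw [← Real.rpow_mul ht.le]
    congr 1
    ring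
  have hinv : ∀ t r : ℝ, 0 < t → r = t ^ ((p * s - 1) / p) → t ^ ((1 - p * s) / p) = r⁻¹ := by
    rintro t _ ht rfl
    rw [← Real.rpow_neg ht.le]
    congr 1
    ring
  have hhalf : ∀ t r : ℝ, 0 < t → r = t ^ ((p * s - 1) / p) →
      t ^ ((1 - p * s) / 2) = (r ^ (p / 2))⁻¹ := by
    rintro t _ ht rfl
    rw [← Real.rpow_mul ht.le, ← Real.rpow_neg ht.le]
    congr 1
    field_simp
    ring
  have hcross : ∀ w : EuclideanSpace ℝ (Fin (n + 1)), ∀ r : ℝ, 0 < w (Fin.last n) →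
      r = w (Fin.last n) ^ ((p * s - 1) / p) → crossDensity p s u w z
        = ENNReal.ofReal ((‖u w‖ ^ p * r ^ (1 - p)) * (a - b) ^ (p - 1) *
          (1 / ‖z.1 - z.2‖ ^ (((n + 1 : ℕ) : ℝ) + p * s))) := by
    intro w r hw hr
    have hr0 : 0 < r := hr ▸ Real.rpow_pos_of_pos hw _
    unfold crossDensity
    rw [hpow _ r hw hr, ← ha, ← hb, abs_of_nonneg hab, ← ENNReal.ofReal_mul (by positivity),
      ← ENNReal.ofReal_mul (by positivity)]
    congr 1
    ring
  constructor
  · rw [hcross z.1 a h1 ha]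
    unfold weightedDensity groundQuotient
    rw [hinv _ a h1 ha, hinv _ b h2 hb, hhalf _ a h1 ha, hhalf _ b h2 hb,
      ← ENNReal.ofReal_mul hc, ← ENNReal.ofReal_add (by positivity) (by positivity),
      Real.mul_rpow ha0.le hb0.le]
    congr 1
    rw [div_inv_eq_mul, div_inv_eq_mul]
    ring
  · rw [hcross z.2 b h2 hb]
    unfold gagliardoDensity
    rw [← ENNReal.ofReal_add (by positivity) (by positivity)]
    congr 1
    ring

lemma crossDensity_add_le {p s c : ℝ} (hp : 2 ≤ p) (hc0 : 0 ≤ c) (hc1 : c ≤ 1)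
    (hc : ∀ τ ∈ Set.Ioo (0 : ℝ) (1 / 2), c ≤ remainderFun p τ) (hpc : p = 2 → c = 1)
    (u : EuclideanSpace ℝ (Fin (n + 1)) → 𝕜)
    {z : EuclideanSpace ℝ (Fin (n + 1)) × EuclideanSpace ℝ (Fin (n + 1))}
    (h1 : 0 < z.1 (Fin.last n)) (h2 : 0 < z.2 (Fin.last n))
    (h : z.2 (Fin.last n) ^ ((p * s - 1) / p) ≤ z.1 (Fin.last n) ^ ((p * s - 1) / p)) :
    crossDensity p s u z.1 z + ENNReal.ofReal c * weightedDensity p s (groundQuotient p s u) z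
      ≤ gagliardoDensity p s u z + crossDensity p s u z.2 z ∧
    (p = 2 →
      crossDensity p s u z.1 z + ENNReal.ofReal c * weightedDensity p s (groundQuotient p s u) z
        = gagliardoDensity p s u z + crossDensity p s u z.2 z) := by
  obtain ⟨e1, e2⟩ := sum_density_eq hp hc0 u h1 h2 rfl rfl h
  rw [e1, e2]
  have hb := Real.rpow_pos_of_pos h2 ((p * s - 1) / p)
  refine ⟨ENNReal.ofReal_le_ofReal (mul_le_mul_of_nonneg_right
    (norm_sub_rpow_ground_state hp hc1 hc hb h _ _) (by positivity)), ?_⟩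
  intro hp2
  have hcc := hpc hp2
  subst hp2 hcc
  rw [norm_sub_sq_ground_state hb h]

/-- Integration of a pointwise identity over cones which keep away from the diagonal; there the
cross terms `P` and `Q` have finite integrals, whose difference is the Hardy term. Then the cones
are let increase to `{y_N < x_N}`. -/
lemma lintegral_gagliardoDensity_of_cross {p s c : ℝ} (hp : 2 ≤ p) (hs0 : 0 < s) (hs1 : s < 1)
    {u : EuclideanSpace ℝ (Fin (n + 1)) → 𝕜} (hu : Measurable u) (hH : hardyTerm p s u < ⊤)
    {P Q : EuclideanSpace ℝ (Fin (n + 1)) × EuclideanSpace ℝ (Fin (n + 1)) → ℝ≥0∞}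
    (hPm : Measurable P) (hQm : Measurable Q) {a b : ℕ → ℝ≥0∞}
    (hP : ∀ m, ∫⁻ z in heightCone n (cutoff m), P z
      = ENNReal.ofReal (kernelConst n (p * s)) * a m * hardyTerm p s u)
    (hQ : ∀ m, ∫⁻ z in heightCone n (cutoff m), Q z
      = ENNReal.ofReal (kernelConst n (p * s)) * b m * hardyTerm p s u)
    (hab : ∀ m, a m =
      (∫⁻ r in Set.Ioo 0 (cutoff m), ENNReal.ofReal (hardyIntegrand p s r)) + b m)
    (hb : ∀ m, b m < ⊤)
    (hle : ∀ z ∈ heightCone n 1,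
      P z + ENNReal.ofReal c * weightedDensity p s (groundQuotient p s u) z
        ≤ gagliardoDensity p s u z + Q z) :
    ∫⁻ z in heightCone n 1, gagliardoDensity p s u z
      = ENNReal.ofReal (kernelConst n (p * s)) *
          ENNReal.ofReal (∫ r in (0 : ℝ)..1, hardyIntegrand p s r) * hardyTerm p s u
        + ENNReal.ofReal c *
          (∫⁻ z in heightCone n 1, weightedDensity p s (groundQuotient p s u) z)
        + ∫⁻ z in heightCone n 1, ((gagliardoDensity p s u z + Q z) -
          (P z + ENNReal.ofReal c * weightedDensity p s (groundQuotient p s u) z)) := by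
  obtain ⟨R, hR⟩ : ∃ R, R = fun z => (gagliardoDensity p s u z + Q z) -
    (P z + ENNReal.ofReal c * weightedDensity p s (groundQuotient p s u) z) := ⟨_, rfl⟩
  have hgm := measurable_gagliardoDensity p s hu
  have hwm := measurable_weightedDensity p s (measurable_groundQuotient p s hu)
  have hRm : Measurable R := by rw [hR]; fun_prop
  have hm : ∀ m, ∫⁻ z in heightCone n (cutoff m), gagliardoDensity p s u z
      = ENNReal.ofReal (kernelConst n (p * s)) *
          (∫⁻ r in Set.Ioo 0 (cutoff m), ENNReal.ofReal (hardyIntegrand p s r)) * hardyTerm p s u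
        + ENNReal.ofReal c * (∫⁻ z in heightCone n (cutoff m),
          weightedDensity p s (groundQuotient p s u) z)
        + ∫⁻ z in heightCone n (cutoff m), R z := by
    intro m
    have h1 : ∫⁻ z in heightCone n (cutoff m), (gagliardoDensity p s u z + Q z)
        = ∫⁻ z in heightCone n (cutoff m), (P z + ENNReal.ofReal c *
          weightedDensity p s (groundQuotient p s u) z + R z) := by
      refine setLIntegral_congr_fun (measurableSet_heightCone n _) fun z hz => ?_
      have hz1 : z ∈ heightCone n 1 := by
        rw [← iUnion_heightCone_cutoff]
        exact Set.mem_iUnion_of_mem m hz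
      rw [hR]
      exact (add_tsub_cancel_of_le (hle z hz1)).symm
    rw [lintegral_add_left hgm, lintegral_add_right _ hRm, lintegral_add_left hPm,
      lintegral_const_mul _ hwm, hP, hQ, hab] at h1
    have hfin : ENNReal.ofReal (kernelConst n (p * s)) * b m * hardyTerm p s u ≠ ⊤ :=
      ENNReal.mul_ne_top (ENNReal.mul_ne_top ENNReal.ofReal_ne_top (hb m).ne) hH.ne
    refine (ENNReal.add_left_inj hfin).1 (h1.trans ?_)
    ring
  have hcone : ∀ f : EuclideanSpace ℝ (Fin (n + 1)) × EuclideanSpace ℝ (Fin (n + 1)) → ℝ≥0∞,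
      Tendsto (fun m => ∫⁻ z in heightCone n (cutoff m), f z) atTop
        (𝓝 (∫⁻ z in heightCone n 1, f z)) := by
    intro f
    have := tendsto_setLIntegral_iUnion volume f (monotone_heightCone_cutoff n)
    rwa [iUnion_heightCone_cutoff] at this
  have hD := tendsto_setLIntegral_iUnion volume (fun r => ENNReal.ofReal (hardyIntegrand p s r))
    (s := fun m => Set.Ioo (0 : ℝ) (cutoff m))
    fun i j h => Set.Ioo_subset_Ioo_right (monotone_cutoff h)
  rw [iUnion_Ioo_cutoff, ← ofReal_integral_hardyIntegrand hp hs0 hs1] at hD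
  have hlim := ((ENNReal.Tendsto.mul_const (ENNReal.Tendsto.const_mul hD
    (Or.inr (ENNReal.ofReal_ne_top (r := kernelConst n (p * s))))) (Or.inr hH.ne)).add
      (ENNReal.Tendsto.const_mul (hcone (weightedDensity p s (groundQuotient p s u)))
        (Or.inr (ENNReal.ofReal_ne_top (r := c))))).add (hcone R)
  have := tendsto_nhds_unique ((hcone (gagliardoDensity p s u)).congr hm) hlim
  rwa [hR] at this

lemma hardyConst_eq (n : ℕ) (p s : ℝ) : hardyConst (n + 1) p s
    = 2 * (kernelConst n (p * s) * ∫ r in (0 : ℝ)..1, hardyIntegrand p s r) := by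
  have e : (((n + 1 : ℕ) : ℝ) - 1) / 2 = (n : ℝ) / 2 := by push_cast; ring
  unfold hardyConst kernelConst
  rw [e]
  ring

lemma hardyConst_pos (n : ℕ) {p s : ℝ} (hp : 2 ≤ p) (hs0 : 0 < s) (hs1 : s < 1)
    (hps : p * s ≠ 1) : 0 < hardyConst (n + 1) p s := by
  rw [hardyConst_eq]
  have h1 := kernelConst_pos n (mul_pos (by linarith : 0 < p) hs0)
  have h2 := integral_hardyIntegrand_pos hp hs0 hs1 hps
  positivity

/-- The ground state representation: the energy is the Hardy term, plus the weighted energy, plus a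
nonnegative rest which vanishes for `p = 2`. -/
theorem exists_gagliardoEnergy_eq {p s c : ℝ} (hp : 2 ≤ p) (hs0 : 0 < s) (hs1 : s < 1)
    (hps : p * s ≠ 1) (hc0 : 0 ≤ c) (hc1 : c ≤ 1)
    (hc : ∀ τ ∈ Set.Ioo (0 : ℝ) (1 / 2), c ≤ remainderFun p τ) (hpc : p = 2 → c = 1)
    {u : EuclideanSpace ℝ (Fin (n + 1)) → 𝕜} (hu : Measurable u) (hH : hardyTerm p s u < ⊤) :
    ∃ ρ : ℝ≥0∞, gagliardoEnergy p s u
      = ENNReal.ofReal (hardyConst (n + 1) p s) * hardyTerm p s u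
        + ENNReal.ofReal c * weightedEnergy p s (groundQuotient p s u) + ρ ∧ (p = 2 → ρ = 0) := by
  have hp0 : 0 < p := by linarith
  have hps0 : 0 < p * s := mul_pos hp0 hs0
  have hk := kernelConst_pos n hps0
  obtain ⟨P, Q, hPQ, hzero⟩ : ∃ P Q : EuclideanSpace ℝ (Fin (n + 1)) ×
      EuclideanSpace ℝ (Fin (n + 1)) → ℝ≥0∞,
      (∫⁻ z in heightCone n 1, gagliardoDensity p s u z
        = ENNReal.ofReal (kernelConst n (p * s)) *
          ENNReal.ofReal (∫ r in (0 : ℝ)..1, hardyIntegrand p s r) * hardyTerm p s u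
        + ENNReal.ofReal c *
          (∫⁻ z in heightCone n 1, weightedDensity p s (groundQuotient p s u) z)
        + ∫⁻ z in heightCone n 1, ((gagliardoDensity p s u z + Q z) -
          (P z + ENNReal.ofReal c * weightedDensity p s (groundQuotient p s u) z))) ∧
      (p = 2 → ∀ z ∈ heightCone n 1,
        P z + ENNReal.ofReal c * weightedDensity p s (groundQuotient p s u) z
          = gagliardoDensity p s u z + Q z) := by
    have hlt : ∀ z ∈ heightCone n 1, z.2 (Fin.last n) < z.1 (Fin.last n) := fun z hz => by
      simpa using hz.2
    rcases hps.lt_or_gt with h | h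
    · -- for `ps < 1` the ground state is larger at `y`, so the points exchange their roles
      have hβ : (p * s - 1) / p ≤ 0 := div_nonpos_of_nonpos_of_nonneg (by linarith) hp0.le
      have hpt : ∀ z ∈ heightCone n 1, _ := fun z hz =>
        crossDensity_add_le (z := z.swap) hp hc0 hc1 hc hpc u hz.1 (heightCone_pos one_pos hz)
          (Real.rpow_le_rpow_of_nonpos hz.1 (hlt z hz).le hβ)
      simp only [crossDensity_swap, gagliardoDensity_swap, weightedDensity_swap, Prod.fst_swap,
        Prod.snd_swap] at hpt
      exact ⟨fun z => crossDensity p s u z.2 z, fun z => crossDensity p s u z.1 z,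
        lintegral_gagliardoDensity_of_cross hp hs0 hs1 hu hH (measurable_crossDensity_snd p s hu)
          (measurable_crossDensity_fst p s hu)
          (fun m => lintegral_crossDensity_snd hp hps0 (cutoff_pos m) (cutoff_lt_one m) hu)
          (fun m => lintegral_crossDensity_fst hps0 (cutoff_pos m) (cutoff_lt_one m) hu)
          (fun m => upperMass_eq hp h (cutoff_lt_one m).le)
          (fun m => lowerMass_lt_top hp hs0 h (cutoff_lt_one m)) fun z hz => (hpt z hz).1,
        fun h2 z hz => (hpt z hz).2 h2⟩
    · have hβ : 0 ≤ (p * s - 1) / p := div_nonneg (by linarith) hp0.le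
      have hpt : ∀ z ∈ heightCone n 1, _ := fun z hz =>
        crossDensity_add_le (z := z) hp hc0 hc1 hc hpc u (heightCone_pos one_pos hz) hz.1
          (Real.rpow_le_rpow hz.1.le (hlt z hz).le hβ)
      exact ⟨fun z => crossDensity p s u z.1 z, fun z => crossDensity p s u z.2 z,
        lintegral_gagliardoDensity_of_cross hp hs0 hs1 hu hH (measurable_crossDensity_fst p s hu)
          (measurable_crossDensity_snd p s hu)
          (fun m => lintegral_crossDensity_fst hps0 (cutoff_pos m) (cutoff_lt_one m) hu)
          (fun m => lintegral_crossDensity_snd hp hps0 (cutoff_pos m) (cutoff_lt_one m) hu)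
          (fun m => lowerMass_eq hp h (cutoff_lt_one m).le)
          (fun m => upperMass_lt_top hp h (cutoff_lt_one m)) fun z hz => (hpt z hz).1,
        fun h2 z hz => (hpt z hz).2 h2⟩
  refine ⟨2 * ∫⁻ z in heightCone n 1, ((gagliardoDensity p s u z + Q z) -
    (P z + ENNReal.ofReal c * weightedDensity p s (groundQuotient p s u) z)), ?_, fun h2 => ?_⟩
  · rw [gagliardoEnergy_eq hu, weightedEnergy_eq (measurable_groundQuotient p s hu), hPQ,
      hardyConst_eq, ENNReal.ofReal_mul two_pos.le, ENNReal.ofReal_mul hk.le, ENNReal.ofReal_ofNat]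
    ring
  · rw [setLIntegral_congr_fun (measurableSet_heightCone n 1) (g := fun _ => 0)
      fun z hz => tsub_eq_zero_of_le (hzero h2 z hz).ge]
    simp

end GroundState

/-! ### Test functions and the completion -/

section Completion

variable {𝕜 : Type*} [RCLike 𝕜] {n : ℕ}

lemma IsTestFunction.continuous {φ : EuclideanSpace ℝ (Fin (n + 1)) → 𝕜} (h : IsTestFunction φ) :
    Continuous φ :=
  h.1.continuous

lemma hardyTerm_lt_top_of_isTestFunction {p s : ℝ} (hp : 2 ≤ p)
    {φ : EuclideanSpace ℝ (Fin (n + 1)) → 𝕜} (h : IsTestFunction φ) : hardyTerm p s φ < ⊤ := by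
  have hcont : ContinuousOn (fun x : EuclideanSpace ℝ (Fin (n + 1)) =>
      ‖φ x‖ ^ p / x (Fin.last n) ^ (p * s)) (tsupport φ) := by
    refine ContinuousOn.div ?_ ?_ fun x hx => (Real.rpow_pos_of_pos (h.2.2 hx) _).ne'
    · exact (h.continuous.norm.rpow_const fun _ => Or.inr (by linarith)).continuousOn
    · exact ContinuousOn.rpow_const (by fun_prop) fun x hx => Or.inl (ne_of_gt (h.2.2 hx))
  have hint := (hcont.integrableOn_compact (μ := volume) h.2.1).hasFiniteIntegral
  refine lt_of_le_of_lt ?_ hint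
  unfold hardyTerm
  rw [← lintegral_indicator (measurableSet_halfSpace n),
    ← lintegral_indicator (isClosed_tsupport φ).measurableSet]
  refine lintegral_mono fun x => ?_
  by_cases hx : x ∈ tsupport φ
  · rw [Set.indicator_of_mem hx, Set.indicator_of_mem (h.2.2 hx), ← ofReal_norm]
    exact ENNReal.ofReal_le_ofReal (le_abs_self _)
  · refine (Set.indicator_le_self _ _ _).trans ?_
    simp [image_eq_zero_of_notMem_tsupport hx, Real.zero_rpow (by linarith : p ≠ 0)]

/-- Integrability of a radial majorant of the Gagliardo integrand of a Lipschitz function: near the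
origin because `s < 1`, at infinity because `s > 0`. -/
lemma integrable_min_norm_rpow (n : ℕ) {p s : ℝ} (hp : 2 ≤ p) (hs0 : 0 < s) (hs1 : s < 1) :
    Integrable fun z : EuclideanSpace ℝ (Fin (n + 1)) =>
      (min 1 ‖z‖) ^ p / ‖z‖ ^ (((n + 1 : ℕ) : ℝ) + p * s) := by
  have hp0 : 0 < p := by linarith
  have hps : 0 < p * s := mul_pos hp0 hs0
  refine (integrable_fun_norm_addHaar volume
    (f := fun r : ℝ => (min 1 r) ^ p / r ^ (((n + 1 : ℕ) : ℝ) + p * s))).2 ?_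
  rw [finrank_euclideanSpace_fin, Nat.add_sub_cancel]
  have e : ∀ y : ℝ, 0 < y → y ^ n • ((min 1 y) ^ p / y ^ (((n + 1 : ℕ) : ℝ) + p * s))
      = (min 1 y) ^ p * y ^ (-(1 + p * s)) := by
    intro y hy
    rw [smul_eq_mul, show ((n + 1 : ℕ) : ℝ) + p * s = n + (1 + p * s) by push_cast; ring,
      Real.rpow_add hy, Real.rpow_natCast, Real.rpow_neg hy.le]
    field_simp
  rw [← Set.Ioc_union_Ioi_eq_Ioi zero_le_one]
  refine IntegrableOn.union ?_ ?_
  · have h1 : IntervalIntegrable (fun y : ℝ => y ^ (p - (1 + p * s))) volume 0 1 :=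
      intervalIntegral.intervalIntegrable_rpow' (by nlinarith)
    rw [intervalIntegrable_iff_integrableOn_Ioc_of_le zero_le_one] at h1
    refine h1.congr_fun (fun y hy => ?_) measurableSet_Ioc
    beta_reduce
    rw [e y hy.1, min_eq_right hy.2, ← Real.rpow_add hy.1, sub_eq_add_neg]
  · have h1 : IntegrableOn (fun y : ℝ => y ^ (-(1 + p * s))) (Set.Ioi 1) :=
      integrableOn_Ioi_rpow_of_lt (by linarith) one_pos
    refine h1.congr_fun (fun y hy => ?_) measurableSet_Ioi
    have hy1 : 1 < y := hy
    beta_reduce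
    rw [e y (one_pos.trans hy1), min_eq_left hy1.le, Real.one_rpow, one_mul]

lemma exists_norm_sub_le_mul_min {φ : EuclideanSpace ℝ (Fin (n + 1)) → 𝕜} (h : IsTestFunction φ) :
    ∃ A : ℝ, 0 ≤ A ∧ ∀ x y, ‖φ x - φ y‖ ≤ A * min 1 ‖x - y‖ := by
  obtain ⟨C, hC⟩ := h.1.lipschitzWith_of_hasCompactSupport h.2.1 (by simp)
  obtain ⟨M, hM⟩ := h.2.1.exists_bound_of_continuous h.continuous
  refine ⟨max C (M + M), C.2.trans (le_max_left _ _), fun x y => ?_⟩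
  rcases min_cases 1 ‖x - y‖ with ⟨h1, -⟩ | ⟨h1, -⟩ <;> rw [h1]
  · rw [mul_one]
    exact ((norm_sub_le _ _).trans (add_le_add (hM x) (hM y))).trans (le_max_right _ _)
  · have := hC.dist_le_mul x y
    rw [dist_eq_norm, dist_eq_norm] at this
    exact this.trans (mul_le_mul_of_nonneg_right (le_max_left _ _) (norm_nonneg _))

lemma gagliardoEnergy_lt_top_of_isTestFunction {p s : ℝ} (hp : 2 ≤ p) (hs0 : 0 < s) (hs1 : s < 1)
    {φ : EuclideanSpace ℝ (Fin (n + 1)) → 𝕜} (h : IsTestFunction φ) :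
    gagliardoEnergy p s φ < ⊤ := by
  have hp0 : 0 < p := by linarith
  obtain ⟨A, hA0, hA⟩ := exists_norm_sub_le_mul_min h
  obtain ⟨G, hG⟩ : ∃ G : EuclideanSpace ℝ (Fin (n + 1)) → ℝ≥0∞, G = fun z =>
    ENNReal.ofReal (A ^ p * ((min 1 ‖z‖) ^ p / ‖z‖ ^ (((n + 1 : ℕ) : ℝ) + p * s))) := ⟨_, rfl⟩
  have hGm : Measurable G := by rw [hG]; fun_prop
  have hGfin : ∫⁻ z, G z < ⊤ := by
    refine lt_of_le_of_lt (lintegral_mono fun z => ?_)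
      ((integrable_min_norm_rpow n hp hs0 hs1).const_mul (A ^ p)).hasFiniteIntegral
    rw [hG, ← ofReal_norm]
    exact ENNReal.ofReal_le_ofReal (le_abs_self _)
  have hGneg : ∀ z, G (-z) = G z := fun z => by simp [hG]
  have hK : MeasurableSet (tsupport φ) := (isClosed_tsupport φ).measurableSet
  obtain ⟨χ, hχ⟩ : ∃ χ : EuclideanSpace ℝ (Fin (n + 1)) → ℝ≥0∞,
    χ = (tsupport φ).indicator fun _ => 1 := ⟨_, rfl⟩
  have hχm : Measurable χ := by rw [hχ]; exact measurable_const.indicator hK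
  have hχfin : ∫⁻ x, χ x < ⊤ := by
    rw [hχ, lintegral_indicator hK]
    simpa using h.2.1.isCompact.measure_lt_top
  -- the integrand vanishes unless one of the two points lies in the support
  have hbound : ∀ x y, ENNReal.ofReal (‖φ x - φ y‖ ^ p / ‖x - y‖ ^ (((n + 1 : ℕ) : ℝ) + p * s))
      ≤ χ x * G (x - y) + χ y * G (x - y) := by
    intro x y
    have h1 : ENNReal.ofReal (‖φ x - φ y‖ ^ p / ‖x - y‖ ^ (((n + 1 : ℕ) : ℝ) + p * s))
        ≤ G (x - y) := by
      rw [hG]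
      refine ENNReal.ofReal_le_ofReal ?_
      rw [← mul_div_assoc, ← Real.mul_rpow hA0 (by positivity)]
      exact div_le_div_of_nonneg_right (Real.rpow_le_rpow (norm_nonneg _) (hA x y) hp0.le)
        (by positivity)
    by_cases hx : x ∈ tsupport φ
    · refine h1.trans (le_add_right ?_)
      rw [hχ, Set.indicator_of_mem hx, one_mul]
    by_cases hy : y ∈ tsupport φ
    · refine h1.trans (le_add_left ?_)
      rw [hχ, Set.indicator_of_mem hy, one_mul]
    · simp [image_eq_zero_of_notMem_tsupport hx, image_eq_zero_of_notMem_tsupport hy,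
        Real.zero_rpow hp0.ne']
  have i1 : ∫⁻ x, ∫⁻ y, χ x * G (x - y) = (∫⁻ x, χ x) * ∫⁻ z, G z := by
    rw [← lintegral_mul_const _ hχm]
    refine lintegral_congr fun x => ?_
    rw [lintegral_const_mul _ (by fun_prop), lintegral_sub_left_eq_self]
  have i2 : ∫⁻ x, ∫⁻ y, χ y * G (x - y) = (∫⁻ x, χ x) * ∫⁻ z, G z := by
    rw [lintegral_lintegral_swap (by fun_prop), ← i1]
    refine lintegral_congr fun y => lintegral_congr fun x => ?_
    rw [← hGneg (y - x), neg_sub]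
  have hfin : (∫⁻ x, χ x) * ∫⁻ z, G z < ⊤ := ENNReal.mul_lt_top hχfin hGfin
  refine lt_of_le_of_lt ?_ (ENNReal.add_lt_top.2 ⟨hfin, hfin⟩)
  calc gagliardoEnergy p s φ
      ≤ ∫⁻ x, ∫⁻ y, (χ x * G (x - y) + χ y * G (x - y)) :=
        (lintegral_mono fun x => (lintegral_mono (hbound x)).trans
          (setLIntegral_le_lintegral _ _)).trans (setLIntegral_le_lintegral _ _)
    _ = ∫⁻ x, ((∫⁻ y, χ x * G (x - y)) + ∫⁻ y, χ y * G (x - y)) :=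
        lintegral_congr fun x => lintegral_add_left (by fun_prop) _
    _ = (∫⁻ x, χ x) * (∫⁻ z, G z) + (∫⁻ x, χ x) * ∫⁻ z, G z := by
        rw [lintegral_add_left, i1, i2]
        exact Measurable.lintegral_prod_right' (f := fun z : EuclideanSpace ℝ (Fin (n + 1)) ×
          EuclideanSpace ℝ (Fin (n + 1)) => χ z.1 * G (z.1 - z.2)) (by fun_prop)

lemma gagliardoEnergy_eq_lintegral_prod {p s : ℝ} {u : EuclideanSpace ℝ (Fin (n + 1)) → 𝕜}
    (hu : Measurable u) : gagliardoEnergy p s u = ∫⁻ z, gagliardoDensity p s u z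
      ∂((volume.restrict (halfSpace n)).prod (volume.restrict (halfSpace n))) := by
  rw [lintegral_prod _ (measurable_gagliardoDensity p s hu).aemeasurable]
  rfl

lemma gagliardoEnergy_add_le {p s : ℝ} (hp : 1 ≤ p) {f g : EuclideanSpace ℝ (Fin (n + 1)) → 𝕜}
    (hf : Measurable f) (hg : Measurable g) :
    gagliardoEnergy p s (f + g)
      ≤ 2 ^ (p - 1) * (gagliardoEnergy p s f + gagliardoEnergy p s g) := by
  rw [gagliardoEnergy_eq_lintegral_prod (hf.add hg), gagliardoEnergy_eq_lintegral_prod hf,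
    gagliardoEnergy_eq_lintegral_prod hg,
    ← lintegral_add_left (measurable_gagliardoDensity p s hf),
    ← lintegral_const_mul' _ _ (ENNReal.rpow_ne_top_of_nonneg (by linarith) (by simp))]
  refine lintegral_mono fun z => ?_
  obtain ⟨K, hK0, hK⟩ : ∃ K : ℝ, 0 ≤ K ∧
      K = (‖z.1 - z.2‖ ^ (((n + 1 : ℕ) : ℝ) + p * s))⁻¹ := ⟨_, by positivity, rfl⟩
  have e : ∀ w : EuclideanSpace ℝ (Fin (n + 1)) → 𝕜, gagliardoDensity p s w z
      = ENNReal.ofReal ‖w z.1 - w z.2‖ ^ p * ENNReal.ofReal K := fun w => by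
    rw [ENNReal.ofReal_rpow_of_nonneg (norm_nonneg _) (by linarith),
      ← ENNReal.ofReal_mul (by positivity), hK, ← div_eq_mul_inv]
    rfl
  rw [e, e, e, ← add_mul, ← mul_assoc]
  refine mul_le_mul_left ?_ _
  refine le_trans (ENNReal.rpow_le_rpow ?_ (by linarith))
    (ENNReal.rpow_add_le_mul_rpow_add_rpow _ _ hp)
  rw [← ENNReal.ofReal_add (norm_nonneg _) (norm_nonneg _)]
  refine ENNReal.ofReal_le_ofReal ?_
  rw [Pi.add_apply, Pi.add_apply, add_sub_add_comm]
  exact norm_add_le _ _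

/-- Fatou's lemma for a sequence of bounded integrals. -/
lemma lintegral_le_of_tendsto_ae {α : Type*} [MeasurableSpace α] {μ : Measure α}
    {f : ℕ → α → ℝ≥0∞} {g : α → ℝ≥0∞} (hf : ∀ k, Measurable (f k))
    (hlim : ∀ᵐ x ∂μ, Tendsto (fun k => f k x) atTop (𝓝 (g x))) {B : ℝ≥0∞}
    (hB : ∀ᶠ k in atTop, ∫⁻ x, f k x ∂μ ≤ B) : ∫⁻ x, g x ∂μ ≤ B := by
  calc ∫⁻ x, g x ∂μ = ∫⁻ x, liminf (fun k => f k x) atTop ∂μ :=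
        lintegral_congr_ae (hlim.mono fun x hx => hx.liminf_eq.symm)
    _ ≤ liminf (fun k => ∫⁻ x, f k x ∂μ) atTop := lintegral_liminf_le hf
    _ ≤ B := (liminf_le_limsup (f := atTop)).trans (limsup_le_of_le (h := hB))

/-- Functions in the completion have a measurable version, for which the energy and the Hardy term
are finite. The latter is bounded along the approximating sequence by the Hardy inequality for test
functions, since the Hardy constant is positive. -/
lemma MemW.exists_measurable {p s : ℝ} (hp : 2 ≤ p) (hs0 : 0 < s) (hs1 : s < 1) (hps : p * s ≠ 1)
    {u : EuclideanSpace ℝ (Fin (n + 1)) → 𝕜} (hu : MemW p s u) :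
    ∃ w : EuclideanSpace ℝ (Fin (n + 1)) → 𝕜, Measurable w ∧
      u =ᵐ[volume.restrict (halfSpace n)] w ∧ gagliardoEnergy p s w < ⊤ ∧ hardyTerm p s w < ⊤ := by
  obtain ⟨φ, hφ, hcauchy, hlim⟩ := hu
  have hφm : ∀ k, Measurable (φ k) := fun k => (hφ k).continuous.measurable
  have hum : AEMeasurable u (volume.restrict (halfSpace n)) :=
    aemeasurable_of_tendsto_metrizable_ae atTop (fun k => (hφm k).aemeasurable) hlim
  have hwlim : ∀ᵐ x ∂(volume.restrict (halfSpace n)),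
      Tendsto (fun k => φ k x) atTop (𝓝 (hum.mk u x)) := by
    filter_upwards [hlim, hum.ae_eq_mk] with x h1 h2
    rwa [← h2]
  have hp0 : 0 ≤ p := by linarith
  obtain ⟨B, hB, hEB⟩ : ∃ B : ℝ≥0∞, B < ⊤ ∧ ∀ᶠ k in atTop, gagliardoEnergy p s (φ k) ≤ B := by
    have h1 : ∀ᶠ m : ℕ × ℕ in atTop, gagliardoEnergy p s (φ m.1 - φ m.2) ≤ 1 :=
      hcauchy.eventually_le_const one_pos
    obtain ⟨m, hm⟩ := eventually_atTop.1 h1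
    refine ⟨2 ^ (p - 1) * (1 + gagliardoEnergy p s (φ m.2)), ?_, ?_⟩
    · exact ENNReal.mul_lt_top (ENNReal.rpow_lt_top_of_nonneg (by linarith) (by simp))
        (ENNReal.add_lt_top.2 ⟨ENNReal.one_lt_top,
          gagliardoEnergy_lt_top_of_isTestFunction hp hs0 hs1 (hφ _)⟩)
    · filter_upwards [eventually_ge_atTop m.1] with k hk
      have h2 := gagliardoEnergy_add_le (s := s) (by linarith : 1 ≤ p) ((hφm k).sub (hφm m.2))
        (hφm m.2)
      rw [sub_add_cancel] at h2
      refine h2.trans ?_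
      gcongr
      exact hm (k, m.2) ⟨hk, le_rfl⟩
  have hD : 0 < hardyConst (n + 1) p s := hardyConst_pos n hp hs0 hs1 hps
  have hHB : ∀ᶠ k in atTop, hardyTerm p s (φ k) ≤ B / ENNReal.ofReal (hardyConst (n + 1) p s) := by
    obtain ⟨c, hc, hc0, hc1, hpc⟩ := exists_isLeast_remainderFun hp
    filter_upwards [hEB] with k hk
    obtain ⟨ρ, hρ, -⟩ := exists_gagliardoEnergy_eq hp hs0 hs1 hps hc0.le hc1
      (fun τ hτ => hc.2 (Set.mem_image_of_mem _ hτ)) hpc (hφm k)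
      (hardyTerm_lt_top_of_isTestFunction (s := s) hp (hφ k))
    rw [ENNReal.le_div_iff_mul_le (Or.inl (ENNReal.ofReal_pos.2 hD).ne')
      (Or.inl ENNReal.ofReal_ne_top), mul_comm]
    refine le_trans ?_ hk
    rw [hρ, add_assoc]
    exact le_self_add
  refine ⟨hum.mk u, hum.measurable_mk, hum.ae_eq_mk, ?_, ?_⟩
  · refine lt_of_le_of_lt ?_ hB
    rw [gagliardoEnergy_eq_lintegral_prod hum.measurable_mk]
    refine lintegral_le_of_tendsto_ae (fun k => measurable_gagliardoDensity p s (hφm k)) ?_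
      (hEB.mono fun k hk => by rwa [← gagliardoEnergy_eq_lintegral_prod (hφm k)])
    filter_upwards [Measure.quasiMeasurePreserving_fst.ae hwlim,
      Measure.quasiMeasurePreserving_snd.ae hwlim] with z h1 h2
    exact ENNReal.tendsto_ofReal
      (((h1.sub h2).norm.rpow_const (Or.inr hp0)).div_const _)
  · refine lt_of_le_of_lt ?_ (ENNReal.div_lt_top hB.ne (ENNReal.ofReal_pos.2 hD).ne')
    refine lintegral_le_of_tendsto_ae (fun k => measurable_hardyDensity p s (hφm k)) ?_ hHB
    filter_upwards [hwlim] with x hx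
    exact ENNReal.tendsto_ofReal ((hx.norm.rpow_const (Or.inr hp0)).div_const _)

lemma gagliardoEnergy_congr_ae {p s : ℝ} {u w : EuclideanSpace ℝ (Fin (n + 1)) → 𝕜}
    (h : u =ᵐ[volume.restrict (halfSpace n)] w) :
    gagliardoEnergy p s u = gagliardoEnergy p s w := by
  refine lintegral_congr_ae ?_
  filter_upwards [h] with x hx
  refine lintegral_congr_ae ?_
  filter_upwards [h] with y hy
  rw [hx, hy]

lemma weightedEnergy_congr_ae {p s : ℝ} {u w : EuclideanSpace ℝ (Fin (n + 1)) → 𝕜}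
    (h : u =ᵐ[volume.restrict (halfSpace n)] w) :
    weightedEnergy p s u = weightedEnergy p s w := by
  refine lintegral_congr_ae ?_
  filter_upwards [h] with x hx
  refine lintegral_congr_ae ?_
  filter_upwards [h] with y hy
  rw [hx, hy]

lemma hardyTerm_congr_ae {p s : ℝ} {u w : EuclideanSpace ℝ (Fin (n + 1)) → 𝕜}
    (h : u =ᵐ[volume.restrict (halfSpace n)] w) : hardyTerm p s u = hardyTerm p s w := by
  refine lintegral_congr_ae ?_
  filter_upwards [h] with x hx
  rw [hx]

end Completion

theorem theorem1p2 {𝕜 : Type*} [RCLike 𝕜] (n : ℕ) (p s : ℝ)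
    (hp : 2 ≤ p) (hs0 : 0 < s) (hs1 : s < 1) (hps : p * s ≠ 1) :
    -- the integral that defines the Hardy constant converges
    IntervalIntegrable (hardyIntegrand p s) volume 0 1 ∧
    -- the minimum `c` that defines `c_p` is attained and lies in `(0, 1]`
    ∃ c : ℝ, IsLeast (remainderFun p '' Set.Ioo (0 : ℝ) (1 / 2)) c ∧ 0 < c ∧ c ≤ 1 ∧
      (p = 2 → c = 1) ∧
      ∀ u v : EuclideanSpace ℝ (Fin (n + 1)) → 𝕜, MemW p s u →
        (∀ x ∈ halfSpace n, v x = (x (Fin.last n) ^ ((1 - p * s) / p)) • u x) →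
        gagliardoEnergy p s u < ⊤ ∧ hardyTerm p s u < ⊤ ∧ weightedEnergy p s v < ⊤ ∧
        (gagliardoEnergy p s u).toReal - hardyConst (n + 1) p s * (hardyTerm p s u).toReal
          ≥ c * (weightedEnergy p s v).toReal ∧
        (p = 2 →
          (gagliardoEnergy p s u).toReal - hardyConst (n + 1) p s * (hardyTerm p s u).toReal
            = c * (weightedEnergy p s v).toReal) := by
  obtain ⟨c, hc, hc0, hc1, hpc⟩ := exists_isLeast_remainderFun hp
  refine ⟨intervalIntegrable_hardyIntegrand hp hs0 hs1, c, hc, hc0, hc1, hpc, ?_⟩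
  intro u v hu hv
  obtain ⟨w, hw, huw, hE, hH⟩ := hu.exists_measurable hp hs0 hs1 hps
  have hvw : v =ᵐ[volume.restrict (halfSpace n)] groundQuotient p s w := by
    filter_upwards [huw, ae_restrict_mem (measurableSet_halfSpace n)] with x h1 h2
    rw [hv x h2, h1]
    rfl
  rw [gagliardoEnergy_congr_ae huw, hardyTerm_congr_ae huw, weightedEnergy_congr_ae hvw]
  obtain ⟨ρ, hρ, hρ2⟩ := exists_gagliardoEnergy_eq hp hs0 hs1 hps hc0.le hc1
    (fun τ hτ => hc.2 (Set.mem_image_of_mem _ hτ)) hpc hw hH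
  have hD := hardyConst_pos n hp hs0 hs1 hps
  have hsum := hE
  rw [hρ, ENNReal.add_lt_top, ENNReal.add_lt_top] at hsum
  obtain ⟨⟨hDH, hcW⟩, hρt⟩ := hsum
  have hW : weightedEnergy p s (groundQuotient p s w) < ⊤ := by
    by_contra hn
    rw [not_lt_top_iff.1 hn, ENNReal.mul_top (ENNReal.ofReal_pos.2 hc0).ne'] at hcW
    exact lt_irrefl _ hcW
  have hreal := congrArg ENNReal.toReal hρ
  rw [ENNReal.toReal_add (ENNReal.add_lt_top.2 ⟨hDH, hcW⟩).ne hρt.ne,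
    ENNReal.toReal_add hDH.ne hcW.ne, ENNReal.toReal_mul, ENNReal.toReal_mul,
    ENNReal.toReal_ofReal hD.le, ENNReal.toReal_ofReal hc0.le] at hreal
  refine ⟨hE, hH, hW, ?_, fun h2 => ?_⟩
  · have := ENNReal.toReal_nonneg (a := ρ)
    linarith
  · rw [hρ2 h2, ENNReal.toReal_zero] at hreal
    linarith
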